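/- Let $q,\tau\in\mathbb C$ with $q=e^{\pi i\tau}$ and $|q|<1$, let $t\in\mathbb C\setminus\{0\}$ and let $P\in\mathbb C[z,z^{-1}]$ be a Laurent polynomial. Let $\mathcal A$ be the generalized $q$-Weyl algebra, i.e. the $\mathbb C$-algebra generated by $u,v,Z,Z^{-1}$ with the relations $ZZ^{-1}=Z^{-1}Z=1$, $ZuZ^{-1}=q^2u$, $ZvZ^{-1}=q^{-2}v$, $uv=P(q^{-1}Z)$, $vu=P(qZ)$. Let $\mathcal A_i=\{a\in\mathcal A: ZaZ^{-1}=q^{2i}a\}$ for $i\in\mathbb Z$, and let $g_t$ be the automorphism of $\mathcal A$ with $g_t(u)=tu$, $g_t(v)=t^{-1}v$, $g_t(Z)=Z$. A $g_t$-twisted trace is a linear map $T\colon\mathcal A\to\mathbb C$ with $T(ab)=T(b\,g_t(a))$ for all $a,b\in\mathcal A$. Let $U=\{z\in\mathbb C:|q|<|z|<|q|^{-1}\}$, let $V=\{x\in\mathbb C: e^{2\pi i x}\in U\}$, and let $\overline V$ be the closure of $V$. Consider the meromorphic functions $w$ on $\mathbb C$ such that $$w(x+1)=w(x),\qquad w(x+\tau)=t\,w(x),$$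 $w\left(x+\frac{\tau}{2}\right)P(e^{2\pi i x})$ is holomorphic (after removing removable singularities) at every point $x\in\overline V$, and $w$ is integrable on $[0,1]$. (1) For every such $w$ there is exactly one linear map $T\colon\mathcal A\to\mathbb C$ that vanishes on $\mathcal A_i$ for all $i\ne0$ and satisfies $$T(R(Z))=\int_0^1 w(x)R(e^{2\pi i x})\,dx\qquad\text{for all }R\in\mathbb C[z,z^{-1}],$$ and this $T$ is a $g_t$-twisted trace. (2) If all roots of $P$ in $\mathbb C\setminus\{0\}$ belong to $U$, then every $g_t$-twisted trace on $\mathcal A$ is obtained from some such $w$ as in (1). -/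

import Mathlib

open scoped LaurentPolynomial

noncomputable section

namespace QWeyl

/-- `∑ₖ cₖ aᵏ` for a Laurent polynomial `P = ∑ₖ cₖ zᵏ`, where `b` plays the role of `a⁻¹`:
negative powers of `a` are read as powers of `b`. -/
def subst {B : Type*} [Semiring B] [Algebra ℂ B] (P : ℂ[T;T⁻¹]) (a b : B) : B :=
  P.coeff.sum fun k c => c • (if 0 ≤ k then a ^ k.toNat else b ^ (-k).toNat)

/-- The value `P(z)` of a Laurent polynomial at a complex number `z` (used for `z ≠ 0`). -/
def value (P : ℂ[T;T⁻¹]) (z : ℂ) : ℂ :=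
  P.coeff.sum fun k c => c * z ^ k

theorem map_subst {B C : Type*} [Semiring B] [Algebra ℂ B] [Semiring C] [Algebra ℂ C]
    (f : B →ₐ[ℂ] C) (P : ℂ[T;T⁻¹]) (a b : B) :
    f (subst P a b) = subst P (f a) (f b) := by
  unfold subst Finsupp.sum
  rw [map_sum]
  refine Finset.sum_congr rfl fun k _ => ?_
  dsimp only
  split_ifs <;> simp

theorem subst_eq_value (P : ℂ[T;T⁻¹]) (z : ℂ) : subst P z z⁻¹ = value P z := by
  unfold subst value Finsupp.sum
  refine Finset.sum_congr rfl fun k _ => ?_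
  dsimp only
  rw [smul_eq_mul]
  congr 1
  split_ifs with h
  · conv_rhs => rw [← Int.toNat_of_nonneg h]
    rw [zpow_natCast]
  · have h' : 0 ≤ -k := by omega
    have hk : k = -((-k).toNat : ℤ) := by rw [Int.toNat_of_nonneg h']; ring
    conv_rhs => rw [hk]
    rw [zpow_neg, zpow_natCast, inv_pow]

/-- The four generators. -/
inductive Gen
  | u | v | Z | Zinv

/-- The generators as elements of the free algebra. -/
abbrev free (x : Gen) : FreeAlgebra ℂ Gen := FreeAlgebra.ι ℂ x

/-- The defining relations: `Z` and `Zinv` are mutually inverse, `Z u Z⁻¹ = q² u`,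
`Z v Z⁻¹ = q⁻² v`, `u v = P(q⁻¹ Z)`, `v u = P(q Z)`. -/
inductive Rel (q : ℂ) (P : ℂ[T;T⁻¹]) : FreeAlgebra ℂ Gen → FreeAlgebra ℂ Gen → Prop
  | Z_Zinv : Rel q P (free .Z * free .Zinv) 1
  | Zinv_Z : Rel q P (free .Zinv * free .Z) 1
  | Z_u : Rel q P (free .Z * free .u * free .Zinv) (q ^ 2 • free .u)
  | Z_v : Rel q P (free .Z * free .v * free .Zinv) ((q ^ 2)⁻¹ • free .v)
  | u_v : Rel q P (free .u * free .v) (subst P (q⁻¹ • free .Z) (q • free .Zinv))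
  | v_u : Rel q P (free .v * free .u) (subst P (q • free .Z) (q⁻¹ • free .Zinv))

/-- The generalized `q`-Weyl algebra with parameter `P`. -/
abbrev Alg (q : ℂ) (P : ℂ[T;T⁻¹]) : Type := RingQuot (Rel q P)

/-- The generators of the generalized `q`-Weyl algebra. -/
def gen (q : ℂ) (P : ℂ[T;T⁻¹]) (x : Gen) : Alg q P :=
  RingQuot.mkAlgHom ℂ (Rel q P) (free x)

/-- The element `R(Z)` of the algebra. -/
def ofZ (q : ℂ) (P R : ℂ[T;T⁻¹]) : Alg q P :=
  subst R (gen q P .Z) (gen q P .Zinv)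

/-- The endomorphism of the algebra with `u ↦ t u`, `v ↦ t⁻¹ v`, `Z ↦ Z`. -/
def twistHom (q : ℂ) (P : ℂ[T;T⁻¹]) (t : ℂˣ) : Alg q P →ₐ[ℂ] Alg q P :=
  RingQuot.liftAlgHom ℂ
    ⟨FreeAlgebra.lift ℂ fun
      | .u => (t : ℂ) • gen q P .u
      | .v => (t : ℂ)⁻¹ • gen q P .v
      | .Z => gen q P .Z
      | .Zinv => gen q P .Zinv, by
      have ht : (t : ℂ) ≠ 0 := t.ne_zero
      intro x y h
      have key := RingQuot.mkAlgHom_rel ℂ h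
      cases h <;>
        simp only [map_mul, map_one, map_smul, map_subst] at key <;>
        simp only [map_mul, map_one, map_smul, map_subst, FreeAlgebra.lift_ι_apply, gen,
          smul_mul_assoc, mul_smul_comm, smul_smul, mul_inv_cancel₀ ht, inv_mul_cancel₀ ht,
          one_smul, key]
      · rw [mul_comm]
      · rw [mul_comm]⟩

theorem twistHom_gen (q : ℂ) (P : ℂ[T;T⁻¹]) (t : ℂˣ) :
    twistHom q P t (gen q P .u) = (t : ℂ) • gen q P .u ∧
    twistHom q P t (gen q P .v) = (t : ℂ)⁻¹ • gen q P .v ∧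
    twistHom q P t (gen q P .Z) = gen q P .Z ∧
    twistHom q P t (gen q P .Zinv) = gen q P .Zinv := by
  refine ⟨?_, ?_, ?_, ?_⟩ <;>
  · conv_lhs => rw [gen]
    rw [twistHom, RingQuot.liftAlgHom_mkAlgHom_apply, FreeAlgebra.lift_ι_apply]

theorem twistHom_comp_inv (q : ℂ) (P : ℂ[T;T⁻¹]) (t : ℂˣ) :
    (twistHom q P t).comp (twistHom q P t⁻¹) = AlgHom.id ℂ (Alg q P) := by
  have ht : (t : ℂ) ≠ 0 := t.ne_zero
  obtain ⟨h1, h2, h3, h4⟩ := twistHom_gen q P t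
  obtain ⟨k1, k2, k3, k4⟩ := twistHom_gen q P t⁻¹
  apply RingQuot.ringQuot_ext'
  apply FreeAlgebra.hom_ext
  funext x
  change twistHom q P t (twistHom q P t⁻¹ (gen q P x)) = gen q P x
  cases x
  · rw [k1, map_smul, h1, smul_smul, Units.val_inv_eq_inv_val, inv_mul_cancel₀ ht, one_smul]
  · rw [k2, map_smul, h2, smul_smul, Units.val_inv_eq_inv_val, inv_inv, mul_inv_cancel₀ ht,
      one_smul]
  · rw [k3, h3]
  · rw [k4, h4]

/-- The automorphism `g_t`, with `u ↦ t u`, `v ↦ t⁻¹ v`, `Z ↦ Z`. -/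
def twist (q : ℂ) (P : ℂ[T;T⁻¹]) (t : ℂˣ) : Alg q P ≃ₐ[ℂ] Alg q P :=
  AlgEquiv.ofAlgHom (twistHom q P t) (twistHom q P t⁻¹) (twistHom_comp_inv q P t)
    (by simpa using twistHom_comp_inv q P t⁻¹)

/-- `T` is a `g`-twisted trace: `T(ab) = T(b g(a))` for all `a, b`. -/
def IsTwistedTrace {A : Type*} [Ring A] [Algebra ℂ A] (g : A ≃ₐ[ℂ] A) (T : A →ₗ[ℂ] ℂ) : Prop :=
  ∀ a b : A, T (a * b) = T (b * g a)

/-- The graded piece `A_i = {a | Z a Z⁻¹ = q²ⁱ a}`. -/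
def graded (q : ℂ) (P : ℂ[T;T⁻¹]) (i : ℤ) : Submodule ℂ (Alg q P) where
  carrier := {a | gen q P .Z * a * gen q P .Zinv = q ^ (2 * i) • a}
  add_mem' {a b} ha hb := by
    simp only [Set.mem_ofPred_eq] at *
    rw [mul_add, add_mul, ha, hb, smul_add]
  zero_mem' := by simp
  smul_mem' c a ha := by
    simp only [Set.mem_ofPred_eq] at *
    rw [mul_smul_comm, smul_mul_assoc, ha, smul_comm]

/-- `T` is the linear functional given by `T(R(Z)) = ∫₀¹ w(x) R(e^{2πix}) dx`, extended by zero to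
the graded pieces of nonzero degree. -/
def IsGivenBy (q : ℂ) (P : ℂ[T;T⁻¹]) (w : ℂ → ℂ) (T : Alg q P →ₗ[ℂ] ℂ) : Prop :=
  (∀ i : ℤ, i ≠ 0 → ∀ a ∈ graded q P i, T a = 0) ∧
  ∀ R : ℂ[T;T⁻¹], T (ofZ q P R) =
    ∫ x in (0 : ℝ)..1, w x * value R (Complex.exp (2 * Real.pi * Complex.I * x))

/-- The open annulus `U = {|q| < |z| < |q|⁻¹}`. -/
def annulus (q : ℂ) : Set ℂ := {z | ‖q‖ < ‖z‖ ∧ ‖z‖ < ‖q‖⁻¹}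

/-- The open strip `V = (1 / 2πi) ln U`. -/
def strip (q : ℂ) : Set ℂ := {x | Complex.exp (2 * Real.pi * Complex.I * x) ∈ annulus q}

/-- The conditions on `w`: it is a meromorphic function with `w(x+1) = w(x)`, `w(x+τ) = t w(x)`, and
the meromorphic function `w(x+τ/2) P(e^{2πix})` is holomorphic (after removing removable
singularities, that is, it has order `≥ 0`) at every point of the closed strip. -/
structure IsWeight (q τ : ℂ) (P : ℂ[T;T⁻¹]) (t : ℂˣ) (w : ℂ → ℂ) : Prop where
  meromorphic : Meromorphic w
  add_one : ∀ x, w (x + 1) = w x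
  add_tau : ∀ x, w (x + τ) = t * w x
  holomorphic : ∀ x ∈ closure (strip q), 0 ≤ meromorphicOrderAt
    (fun y => w (y + τ / 2) * value P (Complex.exp (2 * Real.pi * Complex.I * y))) x

end QWeyl

end

/-! The grading reduces everything to degree zero. Since `|q| < 1`, a twisted trace vanishes in
nonzero degrees (`IsTwistedTrace.map_graded`), so it is a functional `l` on `ℂ[z, z⁻¹]`, and testing
against `u` and `v` leaves the single condition `l((PS)(q⁻¹z)) = t l((PS)(qz))` for all `S`
(`IsTwistedTrace.map_scale`, `isTwistedTrace_of_map_scale`). Every `l` does extend by zero, because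
a representation of `A` on sequences yields a projection to degree zero (`degreeZero`).

For (1), the two sides of the condition are integrals of `w(y+τ/2) (PS)(e^{2πiy})` along the two
edges of the closed strip. No pole lies between them, so Cauchy's theorem makes them equal
(`integral_horizontal_eq`, `IsWeight.integral_scale`).

For (2), the weight on the real line must be `W(z) = ∑ l(zᵐ) z⁻ᵐ` at `z = e^{2πix}`. The condition
says that `(q⁻ᵐ - t qᵐ) l(zᵐ)` satisfies the linear recurrence with characteristic polynomial `P`.
Roots in the annulus make this `O(r^|m|)` with `r < |q|⁻¹` (`exists_radius`), hence `l(zᵐ) =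
O((|q|r)^|m|)` decays (`Growth.of_denominator`) and `W` converges near the unit circle. The series
`F` with coefficients `l((P zᵐ)(q⁻¹z))` decays faster, converges on a neighbourhood of the closed
annulus, and satisfies `F(q⁻¹z) = P(q⁻¹z) W(z)` and `F(qz) = t P(qz) W(z)`. So `F/P`, moved by
`τ/2`, continues `W` over a fundamental strip, and the second identity makes its quasi-periodic
extension match across the real line (`exists_weight`). -/

noncomputable section

namespace QWeyl

open LaurentPolynomial

/-! ### Evaluation and dilation of Laurent polynomials. -/

section Laurent

variable {B : Type*} [Semiring B] [Algebra ℂ B]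

theorem laurent_induction {p : ℂ[T;T⁻¹] → Prop} (add : ∀ f g, p f → p g → p (f + g))
    (smul : ∀ (c : ℂ) f, p f → p (c • f)) (single : ∀ k : ℤ, p (T k)) (f : ℂ[T;T⁻¹]) : p f := by
  refine LaurentPolynomial.induction_on' f add fun n a => ?_
  rw [← smul_eq_C_mul]
  exact smul _ _ (single n)

/-- Evaluation of Laurent polynomials at a unit of a `ℂ`-algebra. -/
def evalUnit (x : Bˣ) : ℂ[T;T⁻¹] →ₐ[ℂ] B :=
  AddMonoidAlgebra.lift ℂ B ℤ ((Units.coeHom B).comp (zpowersHom Bˣ x))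

theorem evalUnit_eq_sum (x : Bˣ) (P : ℂ[T;T⁻¹]) :
    evalUnit x P = P.coeff.sum fun k c => c • ((x ^ k : Bˣ) : B) := by
  rw [evalUnit, AddMonoidAlgebra.lift_apply]
  rfl

@[simp]
theorem evalUnit_T (x : Bˣ) (k : ℤ) : evalUnit x (T k) = ((x ^ k : Bˣ) : B) := by
  rw [evalUnit, T, AddMonoidAlgebra.lift_single]
  simp

theorem subst_eq_evalUnit (x : Bˣ) (P : ℂ[T;T⁻¹]) :
    subst P (x : B) ((x⁻¹ : Bˣ) : B) = evalUnit x P := by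
  rw [evalUnit_eq_sum]
  unfold subst Finsupp.sum
  refine Finset.sum_congr rfl fun k _ => ?_
  dsimp only
  congr 1
  split_ifs with h
  · conv_rhs => rw [← Int.toNat_of_nonneg h]
    rw [zpow_natCast, Units.val_pow_eq_pow_val]
  · have hk : k = -((-k).toNat : ℤ) := by omega
    conv_rhs => rw [hk]
    rw [zpow_neg, zpow_natCast, ← inv_pow, Units.val_pow_eq_pow_val]

theorem value_eq_evalUnit (P : ℂ[T;T⁻¹]) (z : ℂˣ) : value P z = evalUnit z P := by
  rw [← subst_eq_evalUnit, ← subst_eq_value, Units.val_inv_eq_inv_val]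

theorem value_mul (P R : ℂ[T;T⁻¹]) {z : ℂ} (hz : z ≠ 0) :
    value (P * R) z = value P z * value R z := by
  lift z to ℂˣ using hz.isUnit
  simp only [value_eq_evalUnit, map_mul]

theorem value_add (P R : ℂ[T;T⁻¹]) {z : ℂ} (hz : z ≠ 0) :
    value (P + R) z = value P z + value R z := by
  lift z to ℂˣ using hz.isUnit
  simp only [value_eq_evalUnit, map_add]

theorem value_smul (c : ℂ) (R : ℂ[T;T⁻¹]) {z : ℂ} (hz : z ≠ 0) :
    value (c • R) z = c * value R z := by
  lift z to ℂˣ using hz.isUnit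
  simp only [value_eq_evalUnit, map_smul, smul_eq_mul]

theorem value_T (k : ℤ) {z : ℂ} (hz : z ≠ 0) : value (T k) z = z ^ k := by
  lift z to ℂˣ using hz.isUnit
  simp only [value_eq_evalUnit, evalUnit_T, Units.val_zpow_eq_zpow_val]

/-- The substitution `f(z) ↦ f(cz)` on Laurent polynomials. -/
def scale (c : ℂˣ) : ℂ[T;T⁻¹] →ₐ[ℂ] ℂ[T;T⁻¹] :=
  AddMonoidAlgebra.lift ℂ ℂ[T;T⁻¹] ℤ
    { toFun := fun k => ((c ^ k.toAdd : ℂˣ) : ℂ) • T k.toAdd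
      map_one' := by simp
      map_mul' := fun k l => by
        rw [toAdd_mul, zpow_add, T_add, smul_mul_smul_comm, Units.val_mul] }

@[simp]
theorem scale_T (c : ℂˣ) (k : ℤ) : scale c (T k) = ((c : ℂ) ^ k) • T k := by
  rw [scale, T, AddMonoidAlgebra.lift_single, one_smul, ← Units.val_zpow_eq_zpow_val]
  rfl

theorem scale_scale (c d : ℂˣ) (f : ℂ[T;T⁻¹]) : scale c (scale d f) = scale (c * d) f := by
  induction f using laurent_induction with
  | add f g hf hg => simp only [map_add, hf, hg]
  | smul a f hf => simp only [map_smul, hf]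
  | single k => simp [smul_smul, mul_zpow, mul_comm]

@[simp]
theorem scale_one (f : ℂ[T;T⁻¹]) : scale 1 f = f := by
  induction f using laurent_induction with
  | add f g hf hg => simp only [map_add, hf, hg]
  | smul a f hf => simp only [map_smul, hf]
  | single k => simp

theorem value_scale (c : ℂˣ) (f : ℂ[T;T⁻¹]) {z : ℂ} (hz : z ≠ 0) :
    value (scale c f) z = value f (c * z) := by
  have hcz : (c : ℂ) * z ≠ 0 := mul_ne_zero c.ne_zero hz
  induction f using laurent_induction with
  | add f g hf hg => simp only [map_add, value_add _ _ hz, value_add _ _ hcz, hf, hg]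
  | smul a f hf => simp only [map_smul, value_smul _ _ hz, value_smul _ _ hcz, hf]
  | single k => rw [scale_T, value_smul _ _ hz, value_T _ hz, value_T _ hcz, mul_zpow]

end Laurent

/-! ### Grading and spanning set of the `q`-Weyl algebra. -/

section Algebra

variable (q : ℂˣ) (P : ℂ[T;T⁻¹])

theorem gen_Z_mul_Zinv : gen q P .Z * gen q P .Zinv = 1 := by
  simpa [gen] using RingQuot.mkAlgHom_rel ℂ (Rel.Z_Zinv (q := q) (P := P))

theorem gen_Zinv_mul_Z : gen q P .Zinv * gen q P .Z = 1 := by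
  simpa [gen] using RingQuot.mkAlgHom_rel ℂ (Rel.Zinv_Z (q := q) (P := P))

/-- The generator `Z` as a unit. -/
def unitZ : (Alg q P)ˣ where
  val := gen q P .Z
  inv := gen q P .Zinv
  val_inv := gen_Z_mul_Zinv q P
  inv_val := gen_Zinv_mul_Z q P

theorem ofZ_eq (R : ℂ[T;T⁻¹]) : ofZ q P R = evalUnit (unitZ q P) R :=
  subst_eq_evalUnit (unitZ q P) R

theorem evalUnit_scale {B : Type*} [Semiring B] [Algebra ℂ B] (c : ℂˣ) (x y : Bˣ)
    (h : (y : B) = (c : ℂ) • (x : B)) (R : ℂ[T;T⁻¹]) : evalUnit y R = evalUnit x (scale c R) := by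
  have hy : y = Units.map (algebraMap ℂ B).toMonoidHom c * x := by
    ext
    simp [h, Algebra.smul_def]
  have hc : Commute (Units.map (algebraMap ℂ B).toMonoidHom c) x := by
    ext
    simpa using Algebra.commutes (c : ℂ) (x : B)
  induction R using laurent_induction with
  | add f g hf hg => simp only [map_add, hf, hg]
  | smul a f hf => simp only [map_smul, hf]
  | single k =>
    rw [scale_T, map_smul, evalUnit_T, evalUnit_T, hy, hc.mul_zpow,
      ← map_zpow (Units.map (algebraMap ℂ B).toMonoidHom) c k, Algebra.smul_def, Units.val_mul,
      ← Units.val_zpow_eq_zpow_val]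
    rfl

/-- This turns the right-hand sides `P(q^{±1} Z)` of the defining relations into values of dilated
polynomials at the unit `Z`. -/
theorem subst_smul_smul {B : Type*} [Semiring B] [Algebra ℂ B] (c : ℂˣ) (x : Bˣ)
    (R : ℂ[T;T⁻¹]) :
    subst R ((c : ℂ) • (x : B)) ((c : ℂ)⁻¹ • ((x⁻¹ : Bˣ) : B)) = evalUnit x (scale c R) := by
  have h1 : ((c : ℂ) • (x : B)) * ((c : ℂ)⁻¹ • ((x⁻¹ : Bˣ) : B)) = 1 := by
    simp [smul_smul]
  have h2 : ((c : ℂ)⁻¹ • ((x⁻¹ : Bˣ) : B)) * ((c : ℂ) • (x : B)) = 1 := by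
    simp [smul_smul]
  rw [← evalUnit_scale c x ⟨_, _, h1, h2⟩ rfl, ← subst_eq_evalUnit]
  rfl

theorem gen_u_mul_v : gen q P .u * gen q P .v = ofZ q P (scale q⁻¹ P) := by
  have h := RingQuot.mkAlgHom_rel ℂ (Rel.u_v (q := q) (P := P))
  rw [map_mul, map_subst, map_smul, map_smul] at h
  rw [ofZ_eq, ← subst_smul_smul, Units.val_inv_eq_inv_val, inv_inv]
  exact h

theorem gen_v_mul_u : gen q P .v * gen q P .u = ofZ q P (scale q P) := by
  have h := RingQuot.mkAlgHom_rel ℂ (Rel.v_u (q := q) (P := P))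
  rw [map_mul, map_subst, map_smul, map_smul] at h
  rw [ofZ_eq, ← subst_smul_smul]
  exact h

theorem gen_u_mem_graded : gen q P .u ∈ graded q P 1 := by
  have h := RingQuot.mkAlgHom_rel ℂ (Rel.Z_u (q := q) (P := P))
  simp only [map_mul, map_smul] at h
  change _ = ((q : ℂ) ^ (2 * 1 : ℤ)) • _
  norm_cast at h ⊢

theorem gen_v_mem_graded : gen q P .v ∈ graded q P (-1) := by
  have h := RingQuot.mkAlgHom_rel ℂ (Rel.Z_v (q := q) (P := P))
  simp only [map_mul, map_smul] at h
  change _ = ((q : ℂ) ^ (2 * (-1) : ℤ)) • _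
  rw [show (2 * (-1) : ℤ) = -(2 : ℕ) by norm_num, zpow_neg, zpow_natCast]
  exact h

variable {q P}

theorem graded_iff {a : Alg q P} {i : ℤ} :
    a ∈ graded q P i ↔ gen q P .Z * a = ((q : ℂ) ^ (2 * i)) • (a * gen q P .Z) := by
  change _ * _ * _ = _ ↔ _
  constructor <;> intro h
  · rw [← smul_mul_assoc, ← h, mul_assoc _ (gen q P .Zinv), gen_Zinv_mul_Z, mul_one]
  · rw [h, smul_mul_assoc, mul_assoc, gen_Z_mul_Zinv, mul_one]

theorem mul_mem_graded {a b : Alg q P} {i j : ℤ} (ha : a ∈ graded q P i)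
    (hb : b ∈ graded q P j) : a * b ∈ graded q P (i + j) := by
  rw [graded_iff] at *
  rw [← mul_assoc, ha, smul_mul_assoc, mul_assoc, hb, mul_smul_comm, smul_smul, mul_add,
    zpow_add₀ q.ne_zero, mul_assoc]

theorem one_mem_graded : (1 : Alg q P) ∈ graded q P 0 := by
  simp [graded_iff]

theorem pow_mem_graded {a : Alg q P} {i : ℤ} (ha : a ∈ graded q P i) (n : ℕ) :
    a ^ n ∈ graded q P (n * i) := by
  induction n with
  | zero => simpa using one_mem_graded
  | succ n ih =>
    rw [pow_succ, show ((n + 1 : ℕ) : ℤ) * i = n * i + i by push_cast; ring]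
    exact mul_mem_graded ih ha

theorem ofZ_mem_graded (R : ℂ[T;T⁻¹]) : ofZ q P R ∈ graded q P 0 := by
  have hZ : gen q P .Z = evalUnit (unitZ q P) (T 1) := by simp [unitZ]
  rw [graded_iff, ofZ_eq, hZ, ← map_mul, ← map_mul, mul_comm]
  simp

/-- Elements of degree `i` commute with `R(Z)` up to a dilation. -/
theorem ofZ_mul_of_mem_graded {a : Alg q P} {i : ℤ} (ha : a ∈ graded q P i) (R : ℂ[T;T⁻¹]) :
    ofZ q P R * a = a * ofZ q P (scale (q ^ (2 * i)) R) := by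
  have hZ : gen q P .Z * a = ((q : ℂ) ^ (2 * i)) • (a * gen q P .Z) := graded_iff.1 ha
  have hZi : gen q P .Zinv * a = ((q : ℂ) ^ (2 * i))⁻¹ • (a * gen q P .Zinv) := by
    rw [eq_inv_smul_iff₀ (zpow_ne_zero _ q.ne_zero)]
    have := congrArg (fun x => gen q P .Zinv * x * gen q P .Zinv) hZ
    simp only [mul_smul_comm, smul_mul_assoc] at this
    rw [← mul_assoc, gen_Zinv_mul_Z, one_mul, ← mul_assoc (gen q P .Zinv), mul_assoc _ (gen q P .Z),
      gen_Z_mul_Zinv, mul_one] at this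
    exact this.symm
  simp only [ofZ_eq]
  induction R using laurent_induction with
  | add f g hf hg => simp only [map_add, add_mul, mul_add, hf, hg]
  | smul c f hf => simp only [map_smul, smul_mul_assoc, mul_smul_comm, hf]
  | single k =>
    rw [scale_T, map_smul, mul_smul_comm, evalUnit_T, Units.val_zpow_eq_zpow_val]
    induction k with
    | zero => simp
    | succ k ih =>
      rw [zpow_add_one, zpow_add_one₀ (zpow_ne_zero _ q.ne_zero), Units.val_mul, mul_assoc]
      change _ * (gen q P .Z * a) = _ • (a * (_ * gen q P .Z))
      rw [hZ, mul_smul_comm, ← mul_assoc, ih, smul_mul_assoc, smul_smul, mul_comm (_ ^ _)]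
      simp only [mul_assoc]
    | pred k ih =>
      rw [zpow_sub_one, zpow_sub_one₀ (zpow_ne_zero _ q.ne_zero), Units.val_mul, mul_assoc]
      change _ * (gen q P .Zinv * a) = _ • (a * (_ * gen q P .Zinv))
      rw [hZi, mul_smul_comm, ← mul_assoc, ih, smul_mul_assoc, smul_smul, mul_comm _⁻¹]
      simp only [mul_assoc]

/-- `A` is spanned by the elements `uⁿ R(Z)` and `vⁿ R(Z)`. -/
theorem span_eq_top : Submodule.span ℂ
    {a : Alg q P | ∃ (n : ℕ) (R : ℂ[T;T⁻¹]),
      a = gen q P .u ^ n * ofZ q P R ∨ a = gen q P .v ^ n * ofZ q P R} = ⊤ := by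
  set S := Submodule.span ℂ {a : Alg q P | ∃ (n : ℕ) (R : ℂ[T;T⁻¹]),
      a = gen q P .u ^ n * ofZ q P R ∨ a = gen q P .v ^ n * ofZ q P R} with hS
  have hu (n : ℕ) (R : ℂ[T;T⁻¹]) : gen q P .u ^ n * ofZ q P R ∈ S :=
    Submodule.subset_span ⟨n, R, Or.inl rfl⟩
  have hv (n : ℕ) (R : ℂ[T;T⁻¹]) : gen q P .v ^ n * ofZ q P R ∈ S :=
    Submodule.subset_span ⟨n, R, Or.inr rfl⟩
  have hofZ (R : ℂ[T;T⁻¹]) : ∀ a ∈ S, ofZ q P R * a ∈ S := by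
    intro a ha
    induction ha using Submodule.span_induction with
    | mem a ha =>
      obtain ⟨n, R', rfl | rfl⟩ := ha
      · rw [← mul_assoc, ofZ_mul_of_mem_graded (pow_mem_graded (gen_u_mem_graded q P) n),
          mul_assoc, ofZ_eq, ofZ_eq, ← map_mul, ← ofZ_eq]
        exact hu _ _
      · rw [← mul_assoc, ofZ_mul_of_mem_graded (pow_mem_graded (gen_v_mem_graded q P) n),
          mul_assoc, ofZ_eq, ofZ_eq, ← map_mul, ← ofZ_eq]
        exact hv _ _
    | zero => simp
    | add a b _ _ ha hb => rw [mul_add]; exact S.add_mem ha hb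
    | smul c a _ ha => rw [mul_smul_comm]; exact S.smul_mem _ ha
  have hgen (x : Gen) : ∀ a ∈ S, gen q P x * a ∈ S := by
    intro a ha
    cases x with
    | Z => simpa [ofZ_eq, unitZ] using hofZ (T 1) a ha
    | Zinv => simpa [ofZ_eq, unitZ] using hofZ (T (-1)) a ha
    | u =>
      induction ha using Submodule.span_induction with
      | mem a ha =>
        obtain ⟨n, R, rfl | rfl⟩ := ha
        · rw [← mul_assoc, ← pow_succ']
          exact hu _ _
        · rcases n with _ | n
          · simpa using hu 1 R
          · rw [pow_succ', ← mul_assoc, ← mul_assoc, gen_u_mul_v, mul_assoc]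
            exact hofZ _ _ (hv _ _)
      | zero => simp
      | add a b _ _ ha hb => rw [mul_add]; exact S.add_mem ha hb
      | smul c a _ ha => rw [mul_smul_comm]; exact S.smul_mem _ ha
    | v =>
      induction ha using Submodule.span_induction with
      | mem a ha =>
        obtain ⟨n, R, rfl | rfl⟩ := ha
        · rcases n with _ | n
          · simpa using hv 1 R
          · rw [pow_succ', ← mul_assoc, ← mul_assoc, gen_v_mul_u, mul_assoc]
            exact hofZ _ _ (hu _ _)
        · rw [← mul_assoc, ← pow_succ']
          exact hv _ _
      | zero => simp
      | add a b _ _ ha hb => rw [mul_add]; exact S.add_mem ha hb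
      | smul c a _ ha => rw [mul_smul_comm]; exact S.smul_mem _ ha
  -- The span is a left ideal, since it is stable under each generator; it contains `1`, so it is
  -- everything.
  have key (x : FreeAlgebra ℂ Gen) : ∀ a ∈ S, RingQuot.mkAlgHom ℂ (Rel q P) x * a ∈ S := by
    induction x using FreeAlgebra.induction with
    | grade0 c =>
      intro a ha
      rw [AlgHom.commutes, ← Algebra.smul_def]
      exact S.smul_mem _ ha
    | grade1 x => exact hgen x
    | mul x y hx hy =>
      intro a ha
      rw [map_mul, mul_assoc]
      exact hx _ (hy _ ha)
    | add x y hx hy =>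
      intro a ha
      rw [map_add, add_mul]
      exact S.add_mem (hx _ ha) (hy _ ha)
  refine eq_top_iff.2 fun a _ => ?_
  obtain ⟨x, rfl⟩ := RingQuot.mkAlgHom_surjective ℂ (Rel (q : ℂ) P) a
  simpa using key x 1 (by simpa [ofZ_eq] using hu 0 1)

/-- An induction principle: a property stable under linear combinations which holds for all
`uⁿ R(Z)` and `vⁿ R(Z)` holds on `A`. -/
theorem alg_induction {p : Alg q P → Prop} (add : ∀ a b, p a → p b → p (a + b))
    (smul : ∀ (c : ℂ) a, p a → p (c • a))
    (u : ∀ n R, p (gen q P .u ^ n * ofZ q P R))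
    (v : ∀ n R, p (gen q P .v ^ n * ofZ q P R)) (a : Alg q P) : p a := by
  have ha : a ∈ Submodule.span ℂ {a : Alg q P | ∃ (n : ℕ) (R : ℂ[T;T⁻¹]),
      a = gen q P .u ^ n * ofZ q P R ∨ a = gen q P .v ^ n * ofZ q P R} := by
    rw [span_eq_top]
    trivial
  induction ha using Submodule.span_induction with
  | mem a ha =>
    obtain ⟨n, R, rfl | rfl⟩ := ha
    exacts [u n R, v n R]
  | zero => simpa using smul 0 _ (u 0 0)
  | add a b _ _ ha hb => exact add _ _ ha hb
  | smul c a _ ha => exact smul _ _ ha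

theorem u_pow_mul_mem_graded (n : ℕ) (R : ℂ[T;T⁻¹]) :
    gen q P .u ^ n * ofZ q P R ∈ graded q P n := by
  simpa using mul_mem_graded (pow_mem_graded (gen_u_mem_graded q P) n) (ofZ_mem_graded R)

theorem v_pow_mul_mem_graded (n : ℕ) (R : ℂ[T;T⁻¹]) :
    gen q P .v ^ n * ofZ q P R ∈ graded q P (-n) := by
  simpa using mul_mem_graded (pow_mem_graded (gen_v_mem_graded q P) n) (ofZ_mem_graded R)

/-- A functional vanishing in nonzero degrees is determined by its values on the `R(Z)`. -/
theorem functional_ext {T₁ T₂ : Alg q P →ₗ[ℂ] ℂ}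
    (h₁ : ∀ i : ℤ, i ≠ 0 → ∀ a ∈ graded q P i, T₁ a = 0)
    (h₂ : ∀ i : ℤ, i ≠ 0 → ∀ a ∈ graded q P i, T₂ a = 0)
    (h : ∀ R, T₁ (ofZ q P R) = T₂ (ofZ q P R)) : T₁ = T₂ := by
  ext a
  induction a using alg_induction with
  | add a b ha hb => simp only [map_add, ha, hb]
  | smul c a ha => simp only [map_smul, ha]
  | u n R =>
    rcases eq_or_ne n 0 with rfl | hn
    · simpa using h R
    · rw [h₁ n (by exact_mod_cast hn) _ (u_pow_mul_mem_graded n R),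
        h₂ n (by exact_mod_cast hn) _ (u_pow_mul_mem_graded n R)]
  | v n R =>
    rcases eq_or_ne n 0 with rfl | hn
    · simpa using h R
    · rw [h₁ (-n) (by simpa using hn) _ (v_pow_mul_mem_graded n R),
        h₂ (-n) (by simpa using hn) _ (v_pow_mul_mem_graded n R)]

end Algebra

/-! ### A faithful enough representation: independence of the elements `R(Z)`. -/

section Representation

variable (q : ℂˣ) (P : ℂ[T;T⁻¹])

/-- Multiplication by a sequence of Laurent polynomials, as an algebra map. -/
def diagonal : (ℤ → ℂ[T;T⁻¹]) →ₐ[ℂ] Module.End ℂ[T;T⁻¹] (ℤ → ℂ[T;T⁻¹]) where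
  toFun f := LinearMap.pi fun n => f n • LinearMap.proj n
  map_one' := by
    refine LinearMap.ext fun m => funext fun n => ?_
    simp
  map_mul' f g := by
    refine LinearMap.ext fun m => funext fun n => ?_
    simp [mul_assoc]
  map_zero' := by
    refine LinearMap.ext fun m => funext fun n => ?_
    simp
  map_add' f g := by
    refine LinearMap.ext fun m => funext fun n => ?_
    simp [add_mul]
  commutes' c := by
    refine LinearMap.ext fun m => funext fun n => ?_
    simp [Algebra.smul_def]

@[simp]
theorem diagonal_apply (f m : ℤ → ℂ[T;T⁻¹]) (n : ℤ) : diagonal f m n = f n * m n := rfl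

/-- The algebra map sending `R(z)` to the sequence `R(q²ⁿ z)`. -/
def dilations : ℂ[T;T⁻¹] →ₐ[ℂ] (ℤ → ℂ[T;T⁻¹]) :=
  AlgHom.pi fun n => scale (q ^ (2 * n))

@[simp]
theorem dilations_apply (R : ℂ[T;T⁻¹]) (n : ℤ) :
    dilations q R n = scale (q ^ (2 * n)) R := rfl

/-- The shift `m ↦ m(· + k)` on sequences of Laurent polynomials. -/
def shift (k : ℤ) : Module.End ℂ[T;T⁻¹] (ℤ → ℂ[T;T⁻¹]) :=
  LinearMap.pi fun n => LinearMap.proj (n + k)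

@[simp]
theorem shift_apply (k : ℤ) (m : ℤ → ℂ[T;T⁻¹]) (n : ℤ) : shift k m n = m (n + k) := rfl

/-- The action of the generators on `⊕ₙ uⁿ ℂ[Z, Z⁻¹]`, completed to sequences of Laurent
polynomials. -/
def repGen : Gen → Module.End ℂ[T;T⁻¹] (ℤ → ℂ[T;T⁻¹])
  | .u => shift (-1)
  | .v => diagonal (fun n => scale (q ^ (2 * n + 1)) P) * shift 1
  | .Z => diagonal (dilations q (T 1))
  | .Zinv => diagonal (dilations q (T (-1)))

/-- `Z` acting on sequences, as a unit. -/
def repUnit : (Module.End ℂ[T;T⁻¹] (ℤ → ℂ[T;T⁻¹]))ˣ where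
  val := diagonal (dilations q (T 1))
  inv := diagonal (dilations q (T (-1)))
  val_inv := by rw [← map_mul, ← map_mul, ← T_add]; simp
  inv_val := by rw [← map_mul, ← map_mul, ← T_add]; simp

theorem evalUnit_repUnit (R : ℂ[T;T⁻¹]) :
    evalUnit (repUnit q) R = diagonal (dilations q R) := by
  induction R using laurent_induction with
  | add f g hf hg => simp only [map_add, hf, hg]
  | smul c f hf => simp only [map_smul, hf]
  | single k =>
    rw [evalUnit_T]
    induction k with
    | zero => simp
    | succ k ih =>
      rw [zpow_add_one, Units.val_mul, ih, T_add, map_mul, map_mul]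
      rfl
    | pred k ih =>
      rw [zpow_sub_one, Units.val_mul, ih, T_sub, map_mul, map_mul]
      rfl

theorem subst_repGen (c : ℂˣ) (R : ℂ[T;T⁻¹]) :
    subst R ((c : ℂ) • repGen q P .Z) ((c : ℂ)⁻¹ • repGen q P .Zinv) =
      diagonal (dilations q (scale c R)) := by
  rw [← evalUnit_repUnit, ← subst_smul_smul]
  rfl

/-- The hypothesis `h` expresses that the operator of `x` reads its argument at index `n - e`; the
weights of `Z` at `n` and `n - e` differ by `q^(2e)`. -/
theorem repGen_Z_mul (x : Gen) (e : ℤ) (c : ℂ) (hc : c = (q : ℂ) ^ (2 * e))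
    (h : ∀ m n, repGen q P x (dilations q (T (-1)) * m) n =
      scale (q ^ (2 * (n - e))) (T (-1)) * repGen q P x m n) :
    repGen q P .Z * repGen q P x * repGen q P .Zinv = c • repGen q P x := by
  refine LinearMap.ext fun m => funext fun n => ?_
  have h1 : (repGen q P .Z * repGen q P x * repGen q P .Zinv) m n =
      scale (q ^ (2 * n)) (T 1) * repGen q P x (dilations q (T (-1)) * m) n := rfl
  have h2 : (c • repGen q P x) m n = c • repGen q P x m n := rfl
  rw [h1, h2, h, ← mul_assoc, scale_T, scale_T, smul_mul_smul_comm, ← T_add, hc]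
  simp only [add_neg_cancel, T_zero, smul_mul_assoc, one_mul]
  congr 1
  have hq := q.ne_zero
  rw [Units.val_zpow_eq_zpow_val, Units.val_zpow_eq_zpow_val, ← zpow_mul, ← zpow_mul,
    ← zpow_add₀ hq]
  congr 1
  ring

theorem repGen_rel {x y : FreeAlgebra ℂ Gen} (h : Rel q P x y) :
    FreeAlgebra.lift ℂ (repGen q P) x = FreeAlgebra.lift ℂ (repGen q P) y := by
  cases h with
  | Z_Zinv =>
    simp only [map_mul, map_one, FreeAlgebra.lift_ι_apply]
    exact (repUnit q).mul_inv
  | Zinv_Z =>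
    simp only [map_mul, map_one, FreeAlgebra.lift_ι_apply]
    exact (repUnit q).inv_mul
  | Z_u =>
    simp only [map_mul, map_smul, FreeAlgebra.lift_ι_apply]
    exact repGen_Z_mul q P .u 1 _ (by norm_cast) fun m n => rfl
  | Z_v =>
    simp only [map_mul, map_smul, FreeAlgebra.lift_ι_apply]
    refine repGen_Z_mul q P .v (-1) _ ?_ fun m n => ?_
    · rw [show (2 * (-1) : ℤ) = -(2 : ℕ) by norm_num, zpow_neg, zpow_natCast]
    · change scale (q ^ (2 * n + 1)) P * (scale (q ^ (2 * (n + 1))) (T (-1)) * m (n + 1)) =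
        scale (q ^ (2 * (n - -1))) (T (-1)) * (scale (q ^ (2 * n + 1)) P * m (n + 1))
      rw [sub_neg_eq_add, mul_left_comm]
  | u_v =>
    simp only [map_mul, map_smul, map_subst, FreeAlgebra.lift_ι_apply]
    have h := subst_repGen q P q⁻¹ P
    rw [Units.val_inv_eq_inv_val, inv_inv] at h
    rw [h]
    refine LinearMap.ext fun m => funext fun n => ?_
    change scale (q ^ (2 * (n + -1) + 1)) P * m (n + -1 + 1) =
      scale (q ^ (2 * n)) (scale q⁻¹ P) * m n
    rw [scale_scale, neg_add_cancel_right, ← zpow_sub_one]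
    congr 3
    ring_nf
  | v_u =>
    simp only [map_mul, map_smul, map_subst, FreeAlgebra.lift_ι_apply]
    rw [subst_repGen]
    refine LinearMap.ext fun m => funext fun n => ?_
    change scale (q ^ (2 * n + 1)) P * m (n + 1 + -1) = scale (q ^ (2 * n)) (scale q P) * m n
    rw [scale_scale, add_neg_cancel_right, ← zpow_add_one]

/-- The representation of `A` on sequences of Laurent polynomials. -/
def rep : Alg q P →ₐ[ℂ] Module.End ℂ[T;T⁻¹] (ℤ → ℂ[T;T⁻¹]) :=
  RingQuot.liftAlgHom ℂ ⟨FreeAlgebra.lift ℂ (repGen q P), fun _ _ => repGen_rel q P⟩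

theorem rep_gen (x : Gen) : rep q P (gen q P x) = repGen q P x := by
  rw [rep, gen, RingQuot.liftAlgHom_mkAlgHom_apply, FreeAlgebra.lift_ι_apply]

theorem rep_ofZ (R : ℂ[T;T⁻¹]) : rep q P (ofZ q P R) = diagonal (dilations q R) := by
  rw [ofZ, map_subst, rep_gen, rep_gen, ← evalUnit_repUnit, ← subst_eq_evalUnit]
  rfl

/-- The projection of `A` onto its degree zero part `ℂ[Z, Z⁻¹]`. -/
def degreeZero : Alg q P →ₗ[ℂ] ℂ[T;T⁻¹] where
  toFun a := rep q P a (Pi.single 0 1) 0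
  map_add' a b := by simp
  map_smul' c a := by simp

theorem degreeZero_ofZ (R : ℂ[T;T⁻¹]) : degreeZero q P (ofZ q P R) = R := by
  change rep q P (ofZ q P R) (Pi.single 0 1) 0 = R
  simp [rep_ofZ]

/-- `Z` acts on the vector at index `0` by the scalar `z`, and operators are linear over `ℂ[z,
z⁻¹]`, so `Za` and `aZ` have the same projection. In degree `i` they differ by `q^(2i)`, which is
not `1`. -/
theorem degreeZero_eq_zero {i : ℤ} (hi : i ≠ 0) (hq : ‖(q : ℂ)‖ < 1) {a : Alg q P}
    (ha : a ∈ graded q P i) : degreeZero q P a = 0 := by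
  have h1 : rep q P (gen q P .Z * a) (Pi.single 0 1) 0 = T 1 * degreeZero q P a := by
    rw [map_mul, rep_gen]
    simp [repGen, degreeZero]
  have h2 : rep q P (a * gen q P .Z) (Pi.single 0 1) 0 = T 1 * degreeZero q P a := by
    have : repGen q P .Z (Pi.single 0 1) = (T 1 : ℂ[T;T⁻¹]) • Pi.single 0 1 := by
      funext n
      rcases eq_or_ne n 0 with rfl | hn
      · simp [repGen]
      · simp [repGen, hn]
    rw [map_mul, rep_gen, Module.End.mul_apply, this, map_smul]
    rfl
  rw [graded_iff.1 ha, map_smul, LinearMap.smul_apply, Pi.smul_apply, h2] at h1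
  have h3 : ((q : ℂ) ^ (2 * i) - 1) • degreeZero q P a = 0 := by
    rw [← (isUnit_T (R := ℂ) 1).mul_right_eq_zero, mul_smul_comm, sub_smul, h1, one_smul, sub_self]
  refine (smul_eq_zero.1 h3).resolve_left fun h => hi ?_
  have h4 : ‖(q : ℂ)‖ ^ (2 * i) = 1 := by
    rw [← norm_zpow, sub_eq_zero.1 h, norm_one]
  have := (zpow_eq_one_iff_right₀ (norm_nonneg _) hq.ne).1 h4
  omega

end Representation

/-! ### Twisted traces as functionals on Laurent polynomials. -/

section Trace

variable {q : ℂˣ} {P : ℂ[T;T⁻¹]}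

/-- A functional on `ℂ[Z, Z⁻¹]` extends by zero to `A`. -/
theorem exists_extension (hq : ‖(q : ℂ)‖ < 1) (l : ℂ[T;T⁻¹] →ₗ[ℂ] ℂ) :
    ∃ T : Alg q P →ₗ[ℂ] ℂ, (∀ i : ℤ, i ≠ 0 → ∀ a ∈ graded q P i, T a = 0) ∧
      ∀ R, T (ofZ q P R) = l R :=
  ⟨l ∘ₗ degreeZero q P,
    fun i hi a ha => by simp [degreeZero_eq_zero q P hi hq ha],
    fun R => by simp [degreeZero_ofZ]⟩

theorem twist_gen (t : ℂˣ) :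
    twist q P t (gen q P .u) = (t : ℂ) • gen q P .u ∧
    twist q P t (gen q P .v) = (t : ℂ)⁻¹ • gen q P .v ∧
    twist q P t (gen q P .Z) = gen q P .Z ∧
    twist q P t (gen q P .Zinv) = gen q P .Zinv :=
  twistHom_gen q P t

/-- Moving `Z` cyclically, which `g_t` fixes, gives `T(Z a Z⁻¹) = T(a)`, that is `q^(2i) T(a) =
T(a)`. -/
theorem IsTwistedTrace.map_graded {t : ℂˣ} (hq : ‖(q : ℂ)‖ < 1) {T : Alg q P →ₗ[ℂ] ℂ}
    (hT : IsTwistedTrace (twist q P t) T) {i : ℤ} (hi : i ≠ 0) {a : Alg q P}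
    (ha : a ∈ graded q P i) : T a = 0 := by
  have h := hT (gen q P .Z) (a * gen q P .Zinv)
  rw [twist_gen t |>.2.2.1, mul_assoc a, gen_Zinv_mul_Z, mul_one, ← mul_assoc,
    show gen q P .Z * a * gen q P .Zinv = (q : ℂ) ^ (2 * i) • a from ha, map_smul,
    smul_eq_mul] at h
  have h3 : ((q : ℂ) ^ (2 * i) - 1) * T a = 0 := by rw [sub_mul, h]; ring
  refine (mul_eq_zero.1 h3).resolve_left fun h => hi ?_
  have h4 : ‖(q : ℂ)‖ ^ (2 * i) = 1 := by
    rw [← norm_zpow, sub_eq_zero.1 h, norm_one]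
  have := (zpow_eq_one_iff_right₀ (norm_nonneg _) hq.ne).1 h4
  omega

theorem u_mul_v_mul (R : ℂ[T;T⁻¹]) :
    gen q P .u * (gen q P .v * ofZ q P R) = ofZ q P (scale q⁻¹ (P * scale q R)) := by
  rw [← mul_assoc, gen_u_mul_v, ofZ_eq, ofZ_eq, ofZ_eq, ← map_mul, map_mul (scale q⁻¹),
    scale_scale, inv_mul_cancel, scale_one]

theorem v_mul_mul_u (R : ℂ[T;T⁻¹]) :
    gen q P .v * ofZ q P R * gen q P .u = ofZ q P (scale q (P * scale q R)) := by
  rw [mul_assoc, ofZ_mul_of_mem_graded (gen_u_mem_graded q P), ← mul_assoc, gen_v_mul_u, ofZ_eq,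
    ofZ_eq, ofZ_eq, ← map_mul, map_mul (scale q), scale_scale, mul_one, zpow_ofNat, sq]

theorem v_mul_u_mul (R : ℂ[T;T⁻¹]) :
    gen q P .v * (gen q P .u * ofZ q P R) = ofZ q P (scale q (P * scale q⁻¹ R)) := by
  rw [← mul_assoc, gen_v_mul_u, ofZ_eq, ofZ_eq, ofZ_eq, ← map_mul, map_mul (scale q),
    scale_scale, mul_inv_cancel, scale_one]

theorem u_mul_mul_v (R : ℂ[T;T⁻¹]) :
    gen q P .u * ofZ q P R * gen q P .v = ofZ q P (scale q⁻¹ (P * scale q⁻¹ R)) := by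
  rw [mul_assoc, ofZ_mul_of_mem_graded (gen_v_mem_graded q P), ← mul_assoc, gen_u_mul_v, ofZ_eq,
    ofZ_eq, ofZ_eq, ← map_mul, map_mul (scale q⁻¹), scale_scale]
  rw [show (2 * (-1) : ℤ) = -1 + -1 by norm_num, zpow_add, zpow_neg_one]

/-- This is the trace identity for the pair `u`, `v R(Z)`, with `R` dilated so that `S` comes out
undilated. -/
theorem IsTwistedTrace.map_scale {t : ℂˣ} {T : Alg q P →ₗ[ℂ] ℂ}
    (hT : IsTwistedTrace (twist q P t) T) (S : ℂ[T;T⁻¹]) :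
    T (ofZ q P (scale q⁻¹ (P * S))) = t * T (ofZ q P (scale q (P * S))) := by
  have h := hT (gen q P .u) (gen q P .v * ofZ q P (scale q⁻¹ S))
  rw [(twist_gen t).1, u_mul_v_mul, mul_smul_comm, v_mul_mul_u, map_smul, scale_scale,
    mul_inv_cancel, scale_one] at h
  exact h

/-- The trace identity passes from two elements in the first slot to their product, so generators
suffice there. A generator of degree `j` need only be tested against degree `-j`: for `Z^{±1}` this
is commutativity of `ℂ[Z, Z⁻¹]`, and for `u` and `v` it is `h₁`. -/
theorem isTwistedTrace_of_map_scale {t : ℂˣ} {T : Alg q P →ₗ[ℂ] ℂ}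
    (h₀ : ∀ i : ℤ, i ≠ 0 → ∀ a ∈ graded q P i, T a = 0)
    (h₁ : ∀ S : ℂ[T;T⁻¹],
      T (ofZ q P (scale q⁻¹ (P * S))) = t * T (ofZ q P (scale q (P * S)))) :
    IsTwistedTrace (twist q P t) T := by
  have key {x : Alg q P} {j : ℤ} (hx : x ∈ graded q P j) (c : ℂ)
      (hc : twist q P t x = c • x)
      (hu : ∀ (n : ℕ) R, (n : ℤ) = -j → T (x * (gen q P .u ^ n * ofZ q P R)) =
        c * T (gen q P .u ^ n * ofZ q P R * x))
      (hv : ∀ (n : ℕ) R, (n : ℤ) = j → T (x * (gen q P .v ^ n * ofZ q P R)) =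
        c * T (gen q P .v ^ n * ofZ q P R * x)) (b : Alg q P) :
      T (x * b) = T (b * twist q P t x) := by
    rw [hc, mul_smul_comm, map_smul, smul_eq_mul]
    have hne {i : ℤ} {b : Alg q P} (hb : b ∈ graded q P i) (hi : i ≠ -j) :
        T (x * b) = c * T (b * x) := by
      rw [h₀ _ (by omega) _ (mul_mem_graded hx hb), h₀ _ (by omega) _ (mul_mem_graded hb hx),
        mul_zero]
    induction b using alg_induction with
    | add a b ha hb => simp only [mul_add, add_mul, map_add, ha, hb]
    | smul d a ha => simp only [mul_smul_comm, smul_mul_assoc, map_smul, ha, smul_eq_mul]; ring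
    | u n R =>
      by_cases hn : (n : ℤ) = -j
      · exact hu n R hn
      · exact hne (u_pow_mul_mem_graded n R) hn
    | v n R =>
      by_cases hn : (n : ℤ) = j
      · exact hv n R hn
      · exact hne (v_pow_mul_mem_graded n R) (by omega)
  have hZ (R : ℂ[T;T⁻¹]) (hR : twist q P t (ofZ q P R) = ofZ q P R) (b : Alg q P) :
      T (ofZ q P R * b) = T (b * twist q P t (ofZ q P R)) := by
    refine key (ofZ_mem_graded R) 1 (by rw [hR, one_smul]) (fun n S hn => ?_)
      (fun n S hn => ?_) b
    all_goals
      obtain rfl : n = 0 := by omega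
      rw [pow_zero, one_mul, one_mul, ofZ_eq, ofZ_eq, ← map_mul, ← map_mul, mul_comm]
  have hgen (x : Gen) (b : Alg q P) :
      T (gen q P x * b) = T (b * twist q P t (gen q P x)) := by
    obtain ⟨tu, tv, tZ, tZi⟩ := twist_gen (q := q) (P := P) t
    cases x with
    | Z =>
      have hZ1 : ofZ q P (LaurentPolynomial.T 1) = gen q P .Z := by simp [ofZ_eq, unitZ]
      simpa only [hZ1] using hZ (.T 1) (by rw [hZ1, tZ]) b
    | Zinv =>
      have hZ1 : ofZ q P (LaurentPolynomial.T (-1)) = gen q P .Zinv := by simp [ofZ_eq, unitZ]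
      simpa only [hZ1] using hZ (.T (-1)) (by rw [hZ1, tZi]) b
    | u =>
      refine key (gen_u_mem_graded q P) t tu (fun n R hn => by omega) (fun n R hn => ?_) b
      obtain rfl : n = 1 := by omega
      rw [pow_one, u_mul_v_mul, v_mul_mul_u, h₁]
    | v =>
      refine key (gen_v_mem_graded q P) _ tv (fun n R hn => ?_) (fun n R hn => by omega) b
      obtain rfl : n = 1 := by omega
      rw [pow_one, v_mul_u_mul, u_mul_mul_v, h₁, inv_mul_cancel_left₀ t.ne_zero]
  intro a
  obtain ⟨x, rfl⟩ := RingQuot.mkAlgHom_surjective ℂ (Rel (q : ℂ) P) a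
  induction x using FreeAlgebra.induction with
  | grade0 c => simp [Algebra.algebraMap_eq_smul_one]
  | grade1 x => exact hgen x
  | mul x y hx hy =>
    intro b
    rw [map_mul (RingQuot.mkAlgHom ℂ _), mul_assoc, hx, mul_assoc, hy, mul_assoc,
      map_mul (twist q P t)]
  | add x y hx hy =>
    intro b
    rw [map_add, add_mul, map_add, hx, hy, map_add, mul_add, map_add]

end Trace

end QWeyl

end

noncomputable section

namespace QWeyl

open Filter Topology MeasureTheory

/-! ### Shifting a contour for a periodic meromorphic function. -/

section Contour

/-- Functions which agree near every point, away from that point, agree almost everywhere along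
a nonconstant real-affine line. -/
theorem ae_eq_on_line {g G : ℂ → ℂ} (h : ∀ x, g =ᶠ[𝓝[≠] x] G) (a : ℂ) {b : ℂ} (hb : b ≠ 0) :
    ∀ᵐ s : ℝ, g (a + s * b) = G (a + s * b) := by
  -- The exceptional parameters form a discrete set, because the line is injectively parametrised;
  -- such a set is null.
  have hcod : {s : ℝ | g (a + s * b) = G (a + s * b)} ∈ codiscreteWithin (Set.univ : Set ℝ) := by
    rw [mem_codiscreteWithin]
    intro s _
    rw [disjoint_principal_right]
    have ht : Tendsto (fun s : ℝ => a + s * b) (𝓝[≠] s) (𝓝[≠] (a + s * b)) := by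
      refine tendsto_nhdsWithin_of_tendsto_nhds_of_eventually_within _ ?_ ?_
      · exact (Continuous.tendsto (by fun_prop) s).mono_left nhdsWithin_le_nhds
      · filter_upwards [self_mem_nhdsWithin] with x hx
        simpa [hb] using hx
    filter_upwards [ht.eventually (h (a + s * b))] with x hx
    simpa using hx
  have := ae_restrict_le_codiscreteWithin (μ := (volume : Measure ℝ)) MeasurableSet.univ hcod
  rwa [Measure.restrict_univ] at this

/-- The integral over a period of a meromorphic function is the same along two horizontal lines if
there are no poles between them. -/
theorem integral_horizontal_eq {g : ℂ → ℂ} (hg : Meromorphic g) (hper : ∀ x, g (x + 1) = g x)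
    (a b : ℂ) (hord : ∀ x : ℂ, x.im ∈ Set.uIcc a.im b.im → 0 ≤ meromorphicOrderAt g x) :
    ∫ x in (0 : ℝ)..1, g (x + a) = ∫ x in (0 : ℝ)..1, g (x + b) := by
  -- Periodicity absorbs the real part of `c`, so both contours become sides of an upright rectangle
  -- of width `1`.
  have hshift (c : ℂ) :
      ∫ x in (0 : ℝ)..1, g (x + c) = ∫ x in (0 : ℝ)..1, g (x + c.im * Complex.I) := by
    have hp : Function.Periodic (fun x : ℝ => g (x + c.im * Complex.I)) 1 := fun x => by
      dsimp only
      rw [← hper (x + c.im * Complex.I)]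
      push_cast
      ring_nf
    have h := hp.intervalIntegral_add_eq c.re 0
    have h' := intervalIntegral.integral_comp_add_right (a := 0) (b := 1)
      (fun x : ℝ => g (x + c.im * Complex.I)) c.re
    rw [zero_add, add_comm 1] at h'
    rw [zero_add, ← h'] at h
    rw [← h]
    refine intervalIntegral.integral_congr fun x _ => ?_
    conv_lhs => rw [← Complex.re_add_im c]
    push_cast
    rw [add_assoc]
  rw [hshift a, hshift b]
  -- Order `≥ 0` does not control the value of `g` at a removable singularity. The normal form `G`
  -- is genuinely analytic there and changes none of the integrals.
  set G := toMeromorphicNFOn g Set.univ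
  have hgU : MeromorphicOn g Set.univ := fun x _ => hg x
  have hgG (x : ℂ) : g =ᶠ[𝓝[≠] x] G :=
    (hgU.toMeromorphicNFOn_eq_self_on_nhdsNE (Set.mem_univ x)).symm
  have hGan (x : ℂ) (hx : x.im ∈ Set.uIcc a.im b.im) : AnalyticAt ℂ G x := by
    have hNF : MeromorphicNFAt G x := meromorphicNFOn_toMeromorphicNFOn g Set.univ (Set.mem_univ x)
    rw [← hNF.meromorphicOrderAt_nonneg_iff_analyticAt, ← meromorphicOrderAt_congr (hgG x)]
    exact hord x hx
  have hrect := Complex.integral_boundary_rect_eq_zero_of_differentiableOn G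
    (a.im * Complex.I) (1 + b.im * Complex.I) (fun x hx => by
      refine (hGan x ?_).differentiableAt.differentiableWithinAt
      simpa using hx.2)
  have hH (c : ℝ) : ∫ x in (0 : ℝ)..1, G (x + c * Complex.I) =
      ∫ x in (0 : ℝ)..1, g (x + c * Complex.I) := by
    refine intervalIntegral.integral_congr_ae ?_
    filter_upwards [ae_eq_on_line hgG (c * Complex.I) one_ne_zero] with x hx _
    rw [mul_one, add_comm] at hx
    exact hx.symm
  have hV (c : ℝ) : ∫ y in a.im..b.im, G (c + y * Complex.I) =
      ∫ y in a.im..b.im, g (c + y * Complex.I) := by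
    refine intervalIntegral.integral_congr_ae ?_
    filter_upwards [ae_eq_on_line hgG c Complex.I_ne_zero] with x hx _
    exact hx.symm
  have hV1 := hV 1
  have hV0 := hV 0
  simp only [Complex.ofReal_one, Complex.ofReal_zero, zero_add] at hV1 hV0
  simp only [Complex.mul_re, Complex.ofReal_re, Complex.I_re, mul_zero, Complex.ofReal_im,
    Complex.I_im, mul_one, sub_self, Complex.add_re, Complex.one_re, add_zero, Complex.mul_im,
    zero_add, Complex.add_im, Complex.one_im, Complex.ofReal_one, Complex.ofReal_zero,
    hH, hV1, hV0] at hrect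
  -- By periodicity the two vertical sides cancel.
  simp only [add_comm (1 : ℂ), hper] at hrect
  simpa [sub_eq_zero] using hrect

end Contour

/-! ### The annulus as a horizontal strip. -/

section Strip

theorem norm_exp_two_pi_I_mul (x : ℂ) :
    ‖Complex.exp (2 * Real.pi * Complex.I * x)‖ = Real.exp (-(2 * Real.pi * x.im)) := by
  rw [Complex.norm_exp]
  congr 1
  simp

variable {q : ℂˣ} {τ : ℂ}

theorem norm_eq_exp_of_eq (hq : (q : ℂ) = Complex.exp (Real.pi * Complex.I * τ)) :
    ‖(q : ℂ)‖ = Real.exp (-(Real.pi * τ.im)) := by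
  rw [hq, Complex.norm_exp]
  congr 1
  simp

theorem im_pos_of_norm_lt_one (hq : (q : ℂ) = Complex.exp (Real.pi * Complex.I * τ))
    (hq1 : ‖(q : ℂ)‖ < 1) : 0 < τ.im := by
  rw [norm_eq_exp_of_eq hq, Real.exp_lt_one_iff] at hq1
  have := Real.pi_pos
  by_contra! h
  nlinarith

theorem mem_strip_iff (hq : (q : ℂ) = Complex.exp (Real.pi * Complex.I * τ)) (x : ℂ) :
    x ∈ strip q ↔ x.im ∈ Set.Ioo (-(τ.im / 2)) (τ.im / 2) := by
  have hpi := Real.pi_pos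
  change (_ ∧ _) ↔ _
  rw [norm_exp_two_pi_I_mul, norm_eq_exp_of_eq hq, ← Real.exp_neg, Real.exp_lt_exp,
    Real.exp_lt_exp, Set.mem_Ioo, and_comm]
  constructor <;> rintro ⟨h1, h2⟩ <;> constructor <;> nlinarith

theorem mem_closure_strip_iff (hq : (q : ℂ) = Complex.exp (Real.pi * Complex.I * τ))
    (hq1 : ‖(q : ℂ)‖ < 1) (x : ℂ) :
    x ∈ closure (strip q) ↔ x.im ∈ Set.Icc (-(τ.im / 2)) (τ.im / 2) := by
  have hτ := im_pos_of_norm_lt_one hq hq1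
  have : strip q = Complex.im ⁻¹' Set.Ioo (-(τ.im / 2)) (τ.im / 2) :=
    Set.ext (mem_strip_iff hq)
  rw [this, Complex.closure_preimage_im, closure_Ioo (by linarith)]
  rfl

theorem exp_add_half (hq : (q : ℂ) = Complex.exp (Real.pi * Complex.I * τ)) (x : ℂ) :
    Complex.exp (2 * Real.pi * Complex.I * (x + τ / 2)) =
      q * Complex.exp (2 * Real.pi * Complex.I * x) := by
  rw [hq, ← Complex.exp_add]
  congr 1
  ring

theorem exp_sub_half (hq : (q : ℂ) = Complex.exp (Real.pi * Complex.I * τ)) (x : ℂ) :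
    Complex.exp (2 * Real.pi * Complex.I * (x - τ / 2)) =
      (q : ℂ)⁻¹ * Complex.exp (2 * Real.pi * Complex.I * x) := by
  rw [hq, ← Complex.exp_neg, ← Complex.exp_add]
  congr 1
  ring

theorem exp_add_one (x : ℂ) : Complex.exp (2 * Real.pi * Complex.I * (x + 1)) =
    Complex.exp (2 * Real.pi * Complex.I * x) := by
  rw [mul_add, mul_one, Complex.exp_add, Complex.exp_two_pi_mul_I, mul_one]

end Strip

/-! ### Weights define traces. -/

section Weight

variable {q t : ℂˣ} {τ : ℂ} {P : ℂ[T;T⁻¹]} {w : ℂ → ℂ}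

theorem differentiableAt_value (R : ℂ[T;T⁻¹]) {z : ℂ} (hz : z ≠ 0) :
    DifferentiableAt ℂ (value R) z := by
  unfold value Finsupp.sum
  fun_prop (disch := simp [hz])

theorem differentiable_value_exp (R : ℂ[T;T⁻¹]) :
    Differentiable ℂ fun x => value R (Complex.exp (2 * Real.pi * Complex.I * x)) := fun x =>
  (differentiableAt_value R (Complex.exp_ne_zero (2 * Real.pi * Complex.I * x))).comp x
    (f := fun x => Complex.exp (2 * Real.pi * Complex.I * x)) (by fun_prop)

theorem continuous_value_exp (R : ℂ[T;T⁻¹]) :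
    Continuous fun x : ℝ => value R (Complex.exp (2 * Real.pi * Complex.I * x)) :=
  (differentiable_value_exp R).continuous.comp Complex.continuous_ofReal

/-- The functional `R ↦ ∫₀¹ w(x) R(e^{2πix}) dx`. -/
def weightFunctional (hw : IntervalIntegrable (fun x : ℝ => w x) volume 0 1) :
    ℂ[T;T⁻¹] →ₗ[ℂ] ℂ where
  toFun R := ∫ x in (0 : ℝ)..1, w x * value R (Complex.exp (2 * Real.pi * Complex.I * x))
  map_add' R S := by
    rw [← intervalIntegral.integral_add
      (hw.mul_continuousOn (continuous_value_exp R).continuousOn)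
      (hw.mul_continuousOn (continuous_value_exp S).continuousOn)]
    simp only [value_add _ _ (Complex.exp_ne_zero _), mul_add]
  map_smul' c R := by
    rw [RingHom.id_apply, smul_eq_mul, ← intervalIntegral.integral_const_mul]
    simp only [value_smul _ _ (Complex.exp_ne_zero _), mul_left_comm]

/-- At `y = x - τ/2` the integrand `g` is that of the left side; at `y = x + τ/2` it is that of the
right side, with `t` coming from `w(x+τ) = t w(x)`. The polynomial `S` is entire in `x`, so it
creates no poles. -/
theorem IsWeight.integral_scale (hq : (q : ℂ) = Complex.exp (Real.pi * Complex.I * τ))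
    (hq1 : ‖(q : ℂ)‖ < 1) (hw : IsWeight q τ P t w) (S : ℂ[T;T⁻¹]) :
    ∫ x in (0 : ℝ)..1, w x *
      value (scale q⁻¹ (P * S)) (Complex.exp (2 * Real.pi * Complex.I * x)) =
    t * ∫ x in (0 : ℝ)..1, w x *
      value (scale q (P * S)) (Complex.exp (2 * Real.pi * Complex.I * x)) := by
  have hτ := im_pos_of_norm_lt_one hq hq1
  set g : ℂ → ℂ := fun y => w (y + τ / 2) *
    value (P * S) (Complex.exp (2 * Real.pi * Complex.I * y)) with hg
  have hgS (x : ℂ) : AnalyticAt ℂ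
      (fun y => value S (Complex.exp (2 * Real.pi * Complex.I * y))) x :=
    (differentiable_value_exp S).analyticAt x
  have hgm : Meromorphic g := by
    refine Meromorphic.mul
      (Meromorphic.meromorphic_fun_comp_add_const_iff_meromorphic.2 hw.meromorphic) fun x => ?_
    exact ((differentiable_value_exp (P * S)).analyticAt x).meromorphicAt
  have hwP : Meromorphic fun y => w (y + τ / 2) *
      value P (Complex.exp (2 * Real.pi * Complex.I * y)) := by
    refine Meromorphic.mul
      (Meromorphic.meromorphic_fun_comp_add_const_iff_meromorphic.2 hw.meromorphic) fun x => ?_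
    exact ((differentiable_value_exp P).analyticAt x).meromorphicAt
  have hper (x : ℂ) : g (x + 1) = g x := by
    simp only [hg]
    rw [exp_add_one, add_right_comm, hw.add_one]
  have h := integral_horizontal_eq hgm hper (-(τ / 2)) (τ / 2) fun x hx => by
    have hx' : x ∈ closure (strip q) := by
      rw [mem_closure_strip_iff hq hq1]
      rw [Set.uIcc_of_le (by simp; linarith)] at hx
      simpa using hx
    have hgeq : g = (fun y => w (y + τ / 2) *
        value P (Complex.exp (2 * Real.pi * Complex.I * y))) *
        fun y => value S (Complex.exp (2 * Real.pi * Complex.I * y)) := by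
      funext y
      simp only [hg, Pi.mul_apply, value_mul _ _ (Complex.exp_ne_zero _), mul_assoc]
    rw [hgeq, meromorphicOrderAt_mul (hwP x) (hgS x).meromorphicAt]
    exact add_nonneg (hw.holomorphic x hx') (hgS x).meromorphicOrderAt_nonneg
  rw [← intervalIntegral.integral_const_mul]
  refine Eq.trans ?_ (h.trans ?_) <;> refine intervalIntegral.integral_congr fun x _ => ?_
  · simp only [hg, ← sub_eq_add_neg, sub_add_cancel]
    rw [exp_sub_half hq, value_scale _ _ (Complex.exp_ne_zero _), Units.val_inv_eq_inv_val]
  · simp only [hg]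
    rw [exp_add_half hq, value_scale _ _ (Complex.exp_ne_zero _), add_assoc, add_halves,
      hw.add_tau, mul_assoc]

end Weight

end QWeyl

end

noncomputable section

namespace QWeyl

open Filter Topology MeasureTheory LaurentPolynomial Asymptotics

/-! ### Growth of moment sequences. -/

section Growth

/-- The bound `f(m) = O(r^|m|)` for a two-sided sequence. -/
def Growth (r : ℝ) (f : ℤ → ℂ) : Prop := ∃ C : ℝ, ∀ m, ‖f m‖ ≤ C * r ^ m.natAbs

/-- With a nonvanishing comparison sequence, eventual bounds are global ones after enlarging the
constant; finitely many exceptional indices can then be ignored. -/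
theorem growth_iff_nat {r : ℝ} (hr : 0 < r) {f : ℤ → ℂ} : Growth r f ↔
    (fun n : ℕ => f n) =O[atTop] (fun n : ℕ => r ^ n) ∧
    (fun n : ℕ => f (-n)) =O[atTop] (fun n : ℕ => r ^ n) := by
  have h0 (g : ℕ → ℂ) (n : ℕ) (h : r ^ n = 0) : g n = 0 := absurd h (pow_pos hr n).ne'
  have habs (n : ℕ) : ‖r ^ n‖ = r ^ n := Real.norm_of_nonneg (pow_pos hr n).le
  rw [isBigO_nat_atTop_iff (h0 _), isBigO_nat_atTop_iff (h0 _)]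
  simp only [habs]
  constructor
  · rintro ⟨C, hC⟩
    exact ⟨⟨C, fun n => by simpa using hC n⟩, ⟨C, fun n => by simpa using hC (-n)⟩⟩
  · rintro ⟨⟨C, hC⟩, ⟨D, hD⟩⟩
    refine ⟨max C D, fun m => ?_⟩
    obtain ⟨n, rfl | rfl⟩ := m.eq_nat_or_neg
    · exact (hC n).trans (by simp only [Int.natAbs_natCast]; gcongr; exact le_max_left _ _)
    · exact (hD n).trans (by
        simp only [Int.natAbs_neg, Int.natAbs_natCast]; gcongr; exact le_max_right _ _)

/-- This is the recurrence step for a root `α = 0`, which clearing denominators in `P` may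
introduce. -/
theorem Growth.of_shift {r : ℝ} (hr : 1 < r) {f : ℤ → ℂ} (h : Growth r fun m => f (m + 1)) :
    Growth r f := by
  obtain ⟨C, hC⟩ := h
  have hC0 : 0 ≤ C := by simpa using (norm_nonneg _).trans (hC 0)
  refine ⟨C * r, fun m => ?_⟩
  have h := hC (m - 1)
  dsimp only at h
  rw [sub_add_cancel] at h
  refine h.trans ?_
  rw [mul_assoc, ← pow_succ']
  gcongr
  · exact hr.le
  · omega

/-- Solving a first order recurrence preserves growth bounds. -/
theorem Growth.of_recurrence {r : ℝ} (hr : 1 < r) {f : ℤ → ℂ} {α : ℂ} (hα : α ≠ 0)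
    (h1 : ‖α‖ < r) (h2 : ‖α‖⁻¹ < r) (h : Growth r fun m => f (m + 1) - α * f m) :
    Growth r f := by
  have hr0 : 0 < r := by linarith
  obtain ⟨C, hC⟩ := h
  -- The three entries start the induction at `0` and close it upwards and downwards: `C + ‖α‖D ≤
  -- Dr` and `‖α‖⁻¹D + C‖α‖⁻¹r ≤ Dr`.
  set D := max ‖f 0‖ (max (C / (r - ‖α‖)) (C * ‖α‖⁻¹ * r / (r - ‖α‖⁻¹))) with hD
  have hD1 : C ≤ D * (r - ‖α‖) := by
    rw [← div_le_iff₀ (by linarith)]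
    exact (le_max_left _ _).trans (le_max_right _ _)
  have hD2 : C * ‖α‖⁻¹ * r ≤ D * (r - ‖α‖⁻¹) := by
    rw [← div_le_iff₀ (by linarith)]
    exact (le_max_right _ _).trans (le_max_right _ _)
  have hpos (n : ℕ) : ‖f n‖ ≤ D * r ^ n := by
    induction n with
    | zero => simp [hD]
    | succ n ih =>
      have hn : f (n + 1 : ℕ) = (f (n + 1) - α * f n) + α * f n := by push_cast; ring
      have h3 := hC n
      rw [Int.natAbs_natCast] at h3
      calc ‖f (n + 1 : ℕ)‖ ≤ C * r ^ n + ‖α‖ * (D * r ^ n) := by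
            rw [hn]
            refine (norm_add_le _ _).trans (add_le_add h3 ?_)
            rw [norm_mul]
            gcongr
        _ = (C + ‖α‖ * D) * r ^ n := by ring
        _ ≤ (D * r) * r ^ n := by gcongr; linarith
        _ = D * r ^ (n + 1) := by ring
  have hneg (n : ℕ) : ‖f (-n)‖ ≤ D * r ^ n := by
    induction n with
    | zero => simp [hD]
    | succ n ih =>
      have h3 := hC (-(n + 1 : ℕ))
      dsimp only at h3
      rw [Int.natAbs_neg, Int.natAbs_natCast,
        show -((n + 1 : ℕ) : ℤ) + 1 = -n by push_cast; ring] at h3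
      have hn : f (-(n + 1 : ℕ)) = α⁻¹ * (f (-n) - (f (-n) - α * f (-(n + 1 : ℕ)))) := by
        field_simp
        ring
      calc ‖f (-(n + 1 : ℕ))‖ ≤ ‖α‖⁻¹ * (D * r ^ n + C * r ^ (n + 1)) := by
            rw [hn, norm_mul, norm_inv]
            gcongr
            exact (norm_sub_le _ _).trans (add_le_add ih h3)
        _ = (‖α‖⁻¹ * D + C * ‖α‖⁻¹ * r) * r ^ n := by ring
        _ ≤ (D * r) * r ^ n := by gcongr; linarith
        _ = D * r ^ (n + 1) := by ring
  refine ⟨D, fun m => ?_⟩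
  obtain ⟨n, rfl | rfl⟩ := m.eq_nat_or_neg
  · simpa using hpos n
  · simpa using hneg n

/-- A factor `X - α` turns `f(m)` into `f(m+1) - α f(m)`, so the roots are peeled off one at a time.
-/
theorem growth_of_prod_roots {r : ℝ} (hr : 1 < r) (l : ℂ[T;T⁻¹] →ₗ[ℂ] ℂ) (s : Multiset ℂ)
    (hs : ∀ α ∈ s, α ≠ 0 → ‖α‖ < r ∧ ‖α‖⁻¹ < r)
    (h : Growth r fun m => l (Polynomial.toLaurent
      (s.map fun α => Polynomial.X - Polynomial.C α).prod * T m)) :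
    Growth r fun m => l (T m) := by
  induction s using Multiset.induction with
  | empty => simpa using h
  | cons α s ih =>
    refine ih (fun β hβ => hs β (Multiset.mem_cons_of_mem hβ)) ?_
    set Q := Polynomial.toLaurent (s.map fun α => Polynomial.X - Polynomial.C α).prod with hQ
    have hlin (x : ℂ[T;T⁻¹]) : α * l x = l (α • x) := by rw [map_smul, smul_eq_mul]
    have hrec (m : ℤ) : l (Polynomial.toLaurent
        ((α ::ₘ s).map fun α => Polynomial.X - Polynomial.C α).prod * T m) =
        l (Q * T (m + 1)) - α * l (Q * T m) := by
      rw [Multiset.map_cons, Multiset.prod_cons, map_mul Polynomial.toLaurent, ← hQ, hlin,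
        ← map_sub, smul_eq_C_mul, map_sub, Polynomial.toLaurent_X, Polynomial.toLaurent_C, T_add]
      congr 1
      ring
    simp only [hrec] at h
    rcases eq_or_ne α 0 with rfl | hα
    · simp only [zero_mul, sub_zero] at h
      exact Growth.of_shift hr h
    · obtain ⟨h1, h2⟩ := hs α (Multiset.mem_cons_self _ _) hα
      exact Growth.of_recurrence hr hα h1 h2 h

theorem value_toLaurent (p : Polynomial ℂ) {z : ℂ} (hz : z ≠ 0) :
    value (Polynomial.toLaurent p) z = p.eval z := by
  induction p using Polynomial.induction_on' with
  | add p q hp hq => rw [map_add, value_add _ _ hz, hp, hq, Polynomial.eval_add]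
  | monomial n a =>
    rw [← Polynomial.C_mul_X_pow_eq_monomial, Polynomial.toLaurent_C_mul_X_pow, ← smul_eq_C_mul,
      value_smul _ _ hz, value_T _ hz]
    simp

/-- If the roots of `P` lie in the annulus, then for some smaller annulus every functional
annihilating the ideal of `P` has controlled growth. -/
theorem exists_radius {q : ℂˣ} (hq1 : ‖(q : ℂ)‖ < 1) {P : ℂ[T;T⁻¹]}
    (hP : ∀ z : ℂ, z ≠ 0 → value P z = 0 → z ∈ annulus q) :
    ∃ r : ℝ, 1 < r ∧ r < ‖(q : ℂ)‖⁻¹ ∧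
      (∀ z : ℂ, z ≠ 0 → value P z = 0 → ‖z‖ < r ∧ ‖z‖⁻¹ < r) ∧
      ∀ l : ℂ[T;T⁻¹] →ₗ[ℂ] ℂ, (∀ S, l (P * S) = 0) → Growth r fun m => l (T m) := by
  have hq0 : 0 < ‖(q : ℂ)‖ := norm_pos_iff.2 q.ne_zero
  obtain ⟨n, p, hp⟩ := exists_T_pow P
  have hroot {z : ℂ} (hz : z ≠ 0) : p.eval z = 0 ↔ value P z = 0 := by
    rw [← value_toLaurent p hz, hp, value_mul _ _ hz, value_T _ hz]
    simp [hz]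
  -- If `P` were zero, `q` would be a root lying on the boundary of the open annulus, against `hP`.
  have hp0 : p ≠ 0 := by
    rintro rfl
    exact lt_irrefl _ (hP q q.ne_zero ((hroot q.ne_zero).1 (by simp))).1
  -- There are finitely many roots, so every radius close enough to `‖q‖⁻¹` from below works.
  have hev : ∀ᶠ r in 𝓝[<] ‖(q : ℂ)‖⁻¹, 1 < r ∧ r < ‖(q : ℂ)‖⁻¹ ∧
      ∀ α ∈ p.roots.toFinset, α ≠ 0 → ‖α‖ < r ∧ ‖α‖⁻¹ < r := by
    have hlt {a : ℝ} (ha : a < ‖(q : ℂ)‖⁻¹) : ∀ᶠ r in 𝓝[<] ‖(q : ℂ)‖⁻¹, a < r :=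
      nhdsWithin_le_nhds (lt_mem_nhds ha)
    refine (hlt ((one_lt_inv₀ hq0).2 hq1)).and (Eventually.and self_mem_nhdsWithin ?_)
    rw [Filter.eventually_all_finset]
    intro α hα
    rcases eq_or_ne α 0 with rfl | h0
    · simp
    · have hα' : p.eval α = 0 := by simpa [hp0] using hα
      obtain ⟨h1, h2⟩ := hP α h0 ((hroot h0).1 hα')
      filter_upwards [hlt h2, hlt ((inv_lt_inv₀ (norm_pos_iff.2 h0) hq0).2 h1)] with r h3 h4 _
      exact ⟨h3, h4⟩
  obtain ⟨r, hr1, hrq, hr⟩ := hev.exists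
  refine ⟨r, hr1, hrq, fun z hz hz0 => hr z ?_ hz, fun l hl => ?_⟩
  · simpa [hp0] using (hroot hz).2 hz0
  · refine growth_of_prod_roots hr1 l p.roots (fun α hα => hr α (by simpa using hα))
      -- The bound holds with constant `0`: after division by the leading coefficient the sequence
      -- vanishes identically.
      ⟨0, fun m => ?_⟩
    have h1 : l (Polynomial.toLaurent p * T m) = 0 := by rw [hp, mul_assoc, hl]
    rw [(IsAlgClosed.splits p).eq_prod_roots, map_mul Polynomial.toLaurent,
      Polynomial.toLaurent_C, mul_assoc,
      ← smul_eq_C_mul, map_smul, smul_eq_zero] at h1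
    simp [h1.resolve_left (by simpa using hp0)]

/-- In both directions the factor is `q⁻ⁿ` times a sequence with nonzero limit, namely `1 - t q²ⁿ →
1` and `q²ⁿ - t → -t`. It may vanish at some indices, which an eventual bound does not see. -/
theorem Growth.of_denominator {q t : ℂˣ} (hq1 : ‖(q : ℂ)‖ < 1) {r : ℝ} (hr : 0 < r) {c : ℤ → ℂ}
    (h : Growth r fun m => ((q : ℂ) ^ (-m) - t * (q : ℂ) ^ m) * c m) :
    Growth (‖(q : ℂ)‖ * r) c := by
  have hq0 : 0 < ‖(q : ℂ)‖ := norm_pos_iff.2 q.ne_zero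
  have hqn : (q : ℂ) ≠ 0 := q.ne_zero
  rw [growth_iff_nat hr] at h
  rw [growth_iff_nat (mul_pos hq0 hr)]
  have hlim : Tendsto (fun n : ℕ => (q : ℂ) ^ (2 * n)) atTop (𝓝 0) := by
    simp only [pow_mul]
    refine tendsto_pow_atTop_nhds_zero_of_norm_lt_one ?_
    rw [norm_pow]
    exact pow_lt_one₀ hq0.le hq1 two_ne_zero
  have key {u g b : ℕ → ℂ} {a : ℂ} (ha : a ≠ 0) (hu : Tendsto u atTop (𝓝 a))
      (hb : b =O[atTop] fun n : ℕ => r ^ n) (hg : ∀ n, u n * g n = (q : ℂ) ^ n * b n) :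
      g =O[atTop] fun n : ℕ => (‖(q : ℂ)‖ * r) ^ n := by
    have h1 : (fun n => (u n)⁻¹ * ((q : ℂ) ^ n * b n)) =O[atTop]
        fun n : ℕ => (1 : ℝ) * (‖(q : ℂ)‖ ^ n * r ^ n) := by
      refine ((hu.inv₀ ha).isBigO_one ℝ).mul (IsBigO.mul ?_ hb)
      refine IsBigO.of_norm_le fun n => ?_
      rw [norm_pow]
    simp only [one_mul, ← mul_pow] at h1
    refine h1.congr' ?_ EventuallyEq.rfl
    filter_upwards [hu.eventually_ne ha] with n hn
    rw [← hg, inv_mul_cancel_left₀ hn]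
  constructor
  · refine key (u := fun n => 1 - t * (q : ℂ) ^ (2 * n)) (a := 1) one_ne_zero ?_ h.1 fun n => ?_
    · simpa using (hlim.const_mul (t : ℂ)).const_sub 1
    · simp only [zpow_neg, zpow_natCast]
      field_simp
      ring
  · refine key (u := fun n => (q : ℂ) ^ (2 * n) - t) (a := -t) (neg_ne_zero.2 t.ne_zero) ?_ h.2
      fun n => ?_
    · simpa using hlim.sub_const (t : ℂ)
    · simp only [zpow_neg, zpow_natCast, neg_neg]
      field_simp
      ring

/-- One-sided growth bounds are preserved under multiplication by a Laurent polynomial. -/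
theorem isBigO_mul_laurent {s : ℝ} (hs : 0 < s) (l : ℂ[T;T⁻¹] →ₗ[ℂ] ℂ) {e : ℤ}
    (he : e = 1 ∨ e = -1) (h : (fun n : ℕ => l (T (e * n))) =O[atTop] fun n : ℕ => s ^ n)
    (R : ℂ[T;T⁻¹]) :
    (fun n : ℕ => l (R * T (e * n))) =O[atTop] fun n : ℕ => s ^ n := by
  induction R using laurent_induction with
  | add f g hf hg =>
    simp only [add_mul, map_add]
    exact hf.add hg
  | smul c f hf =>
    simp only [smul_mul_assoc, map_smul]
    exact hf.const_smul_left c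
  | single k =>
    rw [isBigO_nat_atTop_iff fun n h => absurd h (pow_pos hs n).ne'] at h
    obtain ⟨C, hC⟩ := h
    -- Multiplication by `zᵏ` moves the index `n` to `n + ek`, since `e² = 1`; this is nonnegative
    -- once `n ≥ |k|`.
    refine IsBigO.of_bound (C * s ^ (e * k)) ?_
    filter_upwards [eventually_ge_atTop k.natAbs] with n hn
    have hee : e * e = 1 := by rcases he with rfl | rfl <;> rfl
    obtain ⟨j, hj⟩ : ∃ j : ℕ, (j : ℤ) = n + e * k := by
      refine ⟨(n + e * k).toNat, Int.toNat_of_nonneg ?_⟩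
      rcases he with rfl | rfl <;> omega
    have hk : k + e * n = e * j := by
      rw [hj]
      linear_combination (-k) * hee
    have h1 := hC j
    rw [Real.norm_of_nonneg (pow_pos hs _).le] at h1 ⊢
    rw [← T_add, hk]
    refine h1.trans_eq ?_
    rw [mul_assoc, ← zpow_natCast s n, ← zpow_natCast s j, ← zpow_add₀ hs.ne', hj, add_comm]

end Growth

/-! ### Convergence and Fourier coefficients of Laurent series. -/

section Series

/-- The Laurent series `∑ aₘ z⁻ᵐ`. -/
def laurentSeries (a : ℤ → ℂ) (z : ℂ) : ℂ := ∑' m, a m * z ^ (-m)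

theorem summable_pow_natAbs {x : ℝ} (h0 : 0 ≤ x) (h1 : x < 1) :
    Summable fun m : ℤ => x ^ m.natAbs := by
  refine Summable.of_nat_of_neg ?_ ?_ <;> simpa using summable_geometric_of_lt_one h0 h1

theorem norm_zpow_le {σ : ℝ} {z : ℂ} (h0 : 0 < σ) (h1 : σ ≤ ‖z‖) (h2 : ‖z‖ ≤ σ⁻¹) (m : ℤ) :
    ‖z ^ m‖ ≤ (σ⁻¹) ^ m.natAbs := by
  rw [norm_zpow]
  obtain ⟨n, rfl | rfl⟩ := m.eq_nat_or_neg
  · rw [zpow_natCast, Int.natAbs_natCast]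
    gcongr
  · rw [zpow_neg, zpow_natCast, ← inv_pow, Int.natAbs_neg, Int.natAbs_natCast]
    gcongr

/-- On the smaller closed annulus the terms are dominated by a geometric series of ratio `s/σ < 1`,
uniformly in `z`. -/
theorem exists_summable_bound {s : ℝ} (hs : 0 < s) {a : ℤ → ℂ} (ha : Growth s a) {σ : ℝ}
    (hσ : s < σ) : ∃ u : ℤ → ℝ, Summable u ∧
      ∀ m z, σ ≤ ‖z‖ → ‖z‖ ≤ σ⁻¹ → ‖a m * z ^ (-m)‖ ≤ u m := by
  obtain ⟨C, hC⟩ := ha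
  have hσ0 : 0 < σ := hs.trans hσ
  refine ⟨fun m => C * (s * σ⁻¹) ^ m.natAbs, (summable_pow_natAbs (by positivity) ?_).mul_left C,
    fun m z h1 h2 => ?_⟩
  · rwa [← div_eq_mul_inv, div_lt_one hσ0]
  · have h3 := norm_zpow_le hσ0 h1 h2 (-m)
    rw [Int.natAbs_neg] at h3
    dsimp only
    rw [norm_mul, mul_pow, ← mul_assoc]
    exact mul_le_mul (hC m) h3 (norm_nonneg _) ((norm_nonneg _).trans (hC m))

theorem exists_between_annulus {s x : ℝ} (hs : 0 < s) (h1 : s < x) (h2 : x < s⁻¹) :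
    ∃ σ, s < σ ∧ σ < x ∧ x < σ⁻¹ := by
  have hx := hs.trans h1
  obtain ⟨σ, h3, h4⟩ := exists_between (lt_min h1 ((lt_inv_comm₀ hx hs).1 h2))
  exact ⟨σ, h3, h4.trans_le (min_le_left _ _),
    (lt_inv_comm₀ (hs.trans h3) hx).1 (h4.trans_le (min_le_right _ _))⟩

theorem hasSum_laurentSeries {s : ℝ} (hs : 0 < s) {a : ℤ → ℂ} (ha : Growth s a) {z : ℂ}
    (h1 : s < ‖z‖) (h2 : ‖z‖ < s⁻¹) :
    HasSum (fun m => a m * z ^ (-m)) (laurentSeries a z) := by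
  obtain ⟨σ, h3, h4, h5⟩ := exists_between_annulus hs h1 h2
  obtain ⟨u, hu, hb⟩ := exists_summable_bound hs ha h3
  exact (Summable.of_norm_bounded hu fun m => hb m z h4.le h5.le).hasSum

theorem differentiableAt_laurentSeries {s : ℝ} (hs : 0 < s) {a : ℤ → ℂ} (ha : Growth s a) {z : ℂ}
    (h1 : s < ‖z‖) (h2 : ‖z‖ < s⁻¹) : DifferentiableAt ℂ (laurentSeries a) z := by
  obtain ⟨σ, h3, h4, h5⟩ := exists_between_annulus hs h1 h2
  obtain ⟨u, hu, hb⟩ := exists_summable_bound hs ha h3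
  have hU : IsOpen {z : ℂ | σ < ‖z‖ ∧ ‖z‖ < σ⁻¹} :=
    (isOpen_lt continuous_const continuous_norm).inter (isOpen_lt continuous_norm continuous_const)
  refine (Complex.differentiableOn_tsum_of_summable_norm hu (fun m => ?_) hU
    fun m w hw => hb m w hw.1.le hw.2.le).differentiableAt (hU.mem_nhds ⟨h4, h5⟩)
  intro w hw
  have hw0 : w ≠ 0 := norm_pos_iff.1 ((hs.trans h3).trans hw.1)
  exact ((differentiableAt_zpow.2 (Or.inl hw0)).const_mul _).differentiableWithinAt

/-- Multiplying a Laurent series by the value of a Laurent polynomial. -/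
theorem hasSum_mul_laurent (l : ℂ[T;T⁻¹] →ₗ[ℂ] ℂ) {z S : ℂ} (hz : z ≠ 0)
    (h : HasSum (fun m => l (T m) * z ^ (-m)) S) (R : ℂ[T;T⁻¹]) :
    HasSum (fun m => l (R * T m) * z ^ (-m)) (value R z * S) := by
  induction R using laurent_induction with
  | add f g hf hg =>
    simp only [value_add _ _ hz, add_mul, map_add]
    exact hf.add hg
  | smul c f hf =>
    simp only [value_smul _ _ hz, smul_mul_assoc, map_smul, smul_eq_mul, mul_assoc]
    exact hf.mul_left c
  | single k =>
    rw [value_T _ hz]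
    have h1 := ((Equiv.addLeft k).hasSum_iff.2 h).mul_left (z ^ k)
    have h2 (m : ℤ) : l (T k * T m) * z ^ (-m) =
        z ^ k * ((fun m => l (T m) * z ^ (-m)) ∘ Equiv.addLeft k) m := by
      rw [Function.comp_apply, Equiv.coe_addLeft, mul_left_comm, ← zpow_add₀ hz, ← T_add]
      congr 2
      ring
    simp only [h2]
    exact h1

/-- The Fourier coefficients of a Laurent series. -/
theorem integral_laurentSeries {s : ℝ} (hs : 0 < s) (hs1 : s < 1) (l : ℂ[T;T⁻¹] →ₗ[ℂ] ℂ)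
    (hl : Growth s fun m => l (T m)) (R : ℂ[T;T⁻¹]) :
    ∫ x in (0 : ℝ)..1, laurentSeries (fun m => l (T m)) (Complex.exp (2 * Real.pi * Complex.I * x))
      * value R (Complex.exp (2 * Real.pi * Complex.I * x)) = l R := by
  have hnorm (x : ℝ) : ‖Complex.exp (2 * Real.pi * Complex.I * x)‖ = 1 := by
    rw [norm_exp_two_pi_I_mul]
    simp
  have hcont : Continuous fun x : ℝ => laurentSeries (fun m => l (T m))
      (Complex.exp (2 * Real.pi * Complex.I * x)) := by
    refine continuous_iff_continuousAt.2 fun x => ?_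
    have h1 := (differentiableAt_laurentSeries hs hl
      (z := Complex.exp (2 * Real.pi * Complex.I * x))
      (by rwa [hnorm]) (by rw [hnorm]; exact (one_lt_inv₀ hs).2 hs1)).continuousAt
    exact ContinuousAt.comp (f := fun x : ℝ => Complex.exp (2 * Real.pi * Complex.I * x)) h1
      (by fun_prop)
  set wf := weightFunctional (w := fun x => laurentSeries (fun m => l (T m))
    (Complex.exp (2 * Real.pi * Complex.I * x))) (hcont.intervalIntegrable 0 1) with hwf
  change wf R = l R
  induction R using laurent_induction with
  | add f g hf hg => rw [map_add, map_add, hf, hg]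
  | smul c f hf => rw [map_smul, map_smul, hf]
  | single k =>
    change ∫ x in (0 : ℝ)..1, laurentSeries (fun m => l (T m))
      (Complex.exp (2 * Real.pi * Complex.I * x))
      * value (T k) (Complex.exp (2 * Real.pi * Complex.I * x)) = l (T k)
    -- The value `σ = 1` gives the dominating series on the unit circle.
    obtain ⟨u, hu, hb⟩ := exists_summable_bound hs hl hs1
    have hsum := intervalIntegral.hasSum_integral_of_dominated_convergence
      (μ := volume) (a := 0) (b := 1)
      (F := fun m x => l (T m) * Complex.exp (2 * Real.pi * Complex.I * (x : ℝ)) ^ (-m) *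
        Complex.exp (2 * Real.pi * Complex.I * (x : ℝ)) ^ k)
      (f := fun x : ℝ => laurentSeries (fun m => l (T m))
        (Complex.exp (2 * Real.pi * Complex.I * x))
        * value (T k) (Complex.exp (2 * Real.pi * Complex.I * x)))
      (fun m _ => u m) (fun m => by
        refine Continuous.aestronglyMeasurable ?_
        simp only [← Complex.exp_int_mul]
        fun_prop)
      (fun m => ae_of_all _ fun x _ => by
        rw [norm_mul, norm_zpow, hnorm, one_zpow, mul_one]
        exact hb m _ (by rw [hnorm]) (by rw [hnorm]; simp))
      (ae_of_all _ fun x _ => hu) (by simp)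
      (ae_of_all _ fun x _ => by
        rw [value_T _ (Complex.exp_ne_zero _)]
        exact (hasSum_laurentSeries hs hl (by rwa [hnorm])
          (by rw [hnorm]; exact (one_lt_inv₀ hs).2 hs1)).mul_right _)
    refine hsum.unique ?_
    have hint (m : ℤ) : ∫ x in (0 : ℝ)..1,
        l (T m) * Complex.exp (2 * Real.pi * Complex.I * (x : ℝ)) ^ (-m) *
        Complex.exp (2 * Real.pi * Complex.I * (x : ℝ)) ^ k = if m = k then l (T k) else 0 := by
      have h1 (x : ℝ) : l (T m) * Complex.exp (2 * Real.pi * Complex.I * (x : ℝ)) ^ (-m) *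
          Complex.exp (2 * Real.pi * Complex.I * (x : ℝ)) ^ k =
          l (T m) * Complex.exp (((k - m : ℤ) : ℂ) * (2 * Real.pi * Complex.I) * x) := by
        rw [mul_assoc, ← zpow_add₀ (Complex.exp_ne_zero _), ← Complex.exp_int_mul]
        congr 2
        push_cast
        ring
      simp only [h1]
      rw [intervalIntegral.integral_const_mul]
      split_ifs with hm
      · subst hm
        simp
      · have h2 : (((k - m : ℤ) : ℂ) * (2 * Real.pi * Complex.I)) ≠ 0 :=
          mul_ne_zero (by exact_mod_cast sub_ne_zero.2 (Ne.symm hm)) Complex.two_pi_I_ne_zero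
        rw [integral_exp_mul_complex h2]
        simp only [Complex.ofReal_one, mul_one, Complex.ofReal_zero, mul_zero, Complex.exp_zero,
          Complex.exp_int_mul_two_pi_mul_I, sub_self, zero_div]
    simp only [hint]
    exact hasSum_ite_eq k (l (T k))

end Series

end QWeyl

end

noncomputable section

namespace QWeyl

open Filter Topology MeasureTheory LaurentPolynomial

/-! ### Quasi-periodic extension from a fundamental strip. -/

section Construction

/-- The quasi-periodic extension, with `w(x + τ) = t w(x)`, of a function on the fundamental strip
`0 ≤ Im x < Im τ`. -/
def quasiPeriodic (τ : ℂ) (t : ℂˣ) (f : ℂ → ℂ) (x : ℂ) : ℂ :=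
  (t : ℂ) ^ ⌊x.im / τ.im⌋ * f (x - ⌊x.im / τ.im⌋ * τ)

variable {τ : ℂ} {t : ℂˣ} {f : ℂ → ℂ}

theorem quasiPeriodic_eq (hτ : 0 < τ.im) {x : ℂ} {n : ℤ} (h1 : n * τ.im ≤ x.im)
    (h2 : x.im < (n + 1) * τ.im) : quasiPeriodic τ t f x = (t : ℂ) ^ n * f (x - n * τ) := by
  have : ⌊x.im / τ.im⌋ = n := by
    rw [Int.floor_eq_iff, le_div_iff₀ hτ, div_lt_iff₀ hτ]
    exact ⟨h1, h2⟩
  rw [quasiPeriodic, this]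

theorem quasiPeriodic_add_tau (hτ : 0 < τ.im) (x : ℂ) :
    quasiPeriodic τ t f (x + τ) = t * quasiPeriodic τ t f x := by
  have : ⌊(x + τ).im / τ.im⌋ = ⌊x.im / τ.im⌋ + 1 := by
    rw [Complex.add_im, add_div, div_self hτ.ne', Int.floor_add_one]
  rw [quasiPeriodic, quasiPeriodic, this, zpow_add_one₀ t.ne_zero]
  push_cast
  ring_nf

theorem quasiPeriodic_add_one (hf : ∀ x, f (x + 1) = f x) (x : ℂ) :
    quasiPeriodic τ t f (x + 1) = quasiPeriodic τ t f x := by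
  rw [quasiPeriodic, quasiPeriodic, Complex.add_im, Complex.one_im, add_zero,
    add_sub_right_comm, hf]

theorem add_int_mul_tau {w : ℂ → ℂ} (h : ∀ x, w (x + τ) = t * w x) (n : ℤ) (x : ℂ) :
    w (x + n * τ) = (t : ℂ) ^ n * w x := by
  induction n with
  | zero => simp
  | succ n ih =>
    rw [zpow_add_one₀ t.ne_zero, mul_comm _ (t : ℂ), mul_assoc, ← ih, ← h]
    push_cast
    ring_nf
  | pred n ih =>
    rw [zpow_sub_one₀ t.ne_zero, mul_comm _ (t : ℂ)⁻¹, mul_assoc, ← ih,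
      eq_inv_mul_iff_mul_eq₀ t.ne_zero,
      ← h]
    push_cast
    ring_nf

/-- A quasi-periodic function which is meromorphic on a fundamental strip is meromorphic. -/
theorem meromorphic_of_add_tau (hτ : 0 < τ.im) {w : ℂ → ℂ} (h : ∀ x, w (x + τ) = t * w x)
    (hw : ∀ x : ℂ, 0 ≤ x.im → x.im < τ.im → MeromorphicAt w x) : Meromorphic w := by
  intro x
  set n := ⌊x.im / τ.im⌋
  have h1 : (n : ℝ) * τ.im ≤ x.im := by rw [← le_div_iff₀ hτ]; exact Int.floor_le _
  have h2 : x.im < (n + 1) * τ.im := by rw [← div_lt_iff₀ hτ]; exact Int.lt_floor_add_one _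
  have hm : MeromorphicAt w (x - n * τ) := hw _ (by simp; linarith) (by simp; linarith)
  have heq : w = fun y => (t : ℂ) ^ n * w (y - n * τ) := by
    funext y
    rw [← add_int_mul_tau h, sub_add_cancel]
  rw [heq]
  exact (MeromorphicAt.const _ x).fun_mul
    (meromorphicAt_fun_comp_sub_const_iff_meromorphicAt.2 hm)

end Construction

/-! ### Every trace comes from a weight. -/

section Existence

variable {q t : ℂˣ} {τ : ℂ} {P : ℂ[T;T⁻¹]}

theorem exists_weight (hq : (q : ℂ) = Complex.exp (Real.pi * Complex.I * τ))
    (hq1 : ‖(q : ℂ)‖ < 1) (hP : ∀ z : ℂ, z ≠ 0 → value P z = 0 → z ∈ annulus q)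
    (l : ℂ[T;T⁻¹] →ₗ[ℂ] ℂ)
    (hl : ∀ S, l (scale q⁻¹ (P * S)) = t * l (scale q (P * S))) :
    ∃ w : ℂ → ℂ, IsWeight q τ P t w ∧ IntervalIntegrable (fun x : ℝ => w x) volume 0 1 ∧
      ∀ R, l R = ∫ x in (0 : ℝ)..1, w x * value R (Complex.exp (2 * Real.pi * Complex.I * x)) := by
  have hτ := im_pos_of_norm_lt_one hq hq1
  have hqn : (q : ℂ) ≠ 0 := q.ne_zero
  have hq0 : 0 < ‖(q : ℂ)‖ := norm_pos_iff.2 hqn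
  obtain ⟨r, hr1, hrq, hroots, hgrowth⟩ := exists_radius hq1 hP
  have hr0 : 0 < r := by linarith
  set ρ := ‖(q : ℂ)‖ * r with hρ
  have hρ0 : 0 < ρ := mul_pos hq0 hr0
  have hρ1 : ρ < 1 := by rwa [hρ, ← lt_inv_mul_iff₀ hq0, mul_one]
  have hqρ : ‖(q : ℂ)‖ < ρ := by rw [hρ]; exact lt_mul_of_one_lt_right hq0 hr1
  have hc : Growth ρ fun m => l (T m) := by
    have h := hgrowth (l ∘ₗ (scale q⁻¹).toLinearMap - (t : ℂ) • l ∘ₗ (scale q).toLinearMap)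
      (fun S => sub_eq_zero.2 (hl S))
    refine Growth.of_denominator (t := t) hq1 hr0 ?_
    refine (congrArg (Growth r) (funext fun m => ?_)).mp h
    simp
    ring
  set l₁ : ℂ[T;T⁻¹] →ₗ[ℂ] ℂ := l ∘ₗ (scale q⁻¹).toLinearMap with hl₁
  set l₂ : ℂ[T;T⁻¹] →ₗ[ℂ] ℂ := l ∘ₗ (scale q).toLinearMap with hl₂
  have hl₁T (m : ℤ) : l₁ (T m) = (q : ℂ) ^ (-m) * l (T m) := by simp [hl₁]
  have hl₂T (m : ℤ) : l₂ (T m) = (q : ℂ) ^ m * l (T m) := by simp [hl₂]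
  have hl₁₂ (S : ℂ[T;T⁻¹]) : l₁ (P * S) = t * l₂ (P * S) := hl S
  have hcn := (growth_iff_nat hρ0).1 hc
  set s := ‖(q : ℂ)‖ * ρ with hs
  have hs0 : 0 < s := mul_pos hq0 hρ0
  -- The coefficients of `F` have two expressions, `l₁(P zᵐ)` and `t l₂(P zᵐ)`. The second gains a
  -- factor `|q|ᵐ` as `m → +∞`, the first gains `|q|^|m|` as `m → -∞`.
  have hd : Growth s fun m => l₁ (P * T m) := by
    have key {g : ℕ → ℂ} (hg : g =O[atTop] fun n : ℕ => ρ ^ n) :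
        (fun n : ℕ => (q : ℂ) ^ n * g n) =O[atTop] fun n : ℕ => s ^ n := by
      simp only [hs, mul_pow]
      refine Asymptotics.IsBigO.mul (Asymptotics.IsBigO.of_norm_le fun n => ?_) hg
      rw [norm_pow]
    refine (growth_iff_nat hs0).2 ⟨?_, ?_⟩
    · simp only [hl₁₂]
      refine Asymptotics.IsBigO.const_mul_left ?_ _
      have h := isBigO_mul_laurent hs0 l₂ (Or.inl rfl) ?_ P
      · simpa only [one_mul] using h
      · simpa only [one_mul, hl₂T, zpow_natCast] using key hcn.1
    · have h := isBigO_mul_laurent hs0 l₁ (Or.inr rfl) ?_ P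
      · simpa only [neg_mul, one_mul] using h
      · simpa only [neg_mul, one_mul, hl₁T, neg_neg, zpow_natCast] using key hcn.2
  set W := laurentSeries fun m => l (T m)
  set F := laurentSeries fun m => l₁ (P * T m)
  have hsρ : s < ρ := by rw [hs]; exact mul_lt_of_lt_one_left hρ0 hq1
  -- This makes the annulus of convergence of `F` contain the closure of `U`.
  have hsq : s < ‖(q : ℂ)‖ := by rw [hs]; exact mul_lt_of_lt_one_right hq0 hρ1
  have hsqi : ‖(q : ℂ)‖⁻¹ < s⁻¹ := (inv_lt_inv₀ hq0 hs0).2 hsq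
  have hF₁ {z : ℂ} (h1 : ρ < ‖z‖) (h2 : ‖z‖ < ρ⁻¹) :
      F ((q : ℂ)⁻¹ * z) = value P ((q : ℂ)⁻¹ * z) * W z := by
    have hz : z ≠ 0 := norm_pos_iff.1 (hρ0.trans h1)
    have h3 : HasSum (fun m => l₁ (T m) * ((q : ℂ)⁻¹ * z) ^ (-m)) (W z) := by
      have h4 (m : ℤ) : l₁ (T m) * ((q : ℂ)⁻¹ * z) ^ (-m) = l (T m) * z ^ (-m) := by
        rw [hl₁T, mul_zpow, inv_zpow, zpow_neg, inv_inv]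
        field_simp
      simp only [h4]
      exact hasSum_laurentSeries hρ0 hc h1 h2
    exact (hasSum_mul_laurent l₁ (mul_ne_zero (inv_ne_zero hqn) hz) h3 P).tsum_eq
  have hF₂ {z : ℂ} (h1 : ρ < ‖z‖) (h2 : ‖z‖ < ρ⁻¹) :
      F (q * z) = t * (value P (q * z) * W z) := by
    have hz : z ≠ 0 := norm_pos_iff.1 (hρ0.trans h1)
    have h3 : HasSum (fun m => l₂ (T m) * ((q : ℂ) * z) ^ (-m)) (W z) := by
      have h4 (m : ℤ) : l₂ (T m) * ((q : ℂ) * z) ^ (-m) = l (T m) * z ^ (-m) := by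
        rw [hl₂T, mul_zpow, zpow_neg]
        field_simp
      simp only [h4]
      exact hasSum_laurentSeries hρ0 hc h1 h2
    have h5 := (hasSum_mul_laurent l₂ (mul_ne_zero hqn hz) h3 P).mul_left (t : ℂ)
    simp only [← mul_assoc, ← hl₁₂] at h5
    rw [← mul_assoc]
    exact h5.tsum_eq
  -- Roots of `P` satisfy `r⁻¹ < |z| < r`, while `|q⁻¹z| > r` here; below, `|qz| < r⁻¹`.
  have hP₁ {z : ℂ} (h1 : ρ < ‖z‖) : value P ((q : ℂ)⁻¹ * z) ≠ 0 := fun h => by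
    have hz : z ≠ 0 := norm_pos_iff.1 (hρ0.trans h1)
    have h3 := (hroots _ (mul_ne_zero (inv_ne_zero hqn) hz) h).1
    rw [norm_mul, norm_inv, inv_mul_lt_iff₀ hq0] at h3
    exact lt_asymm h1 h3
  have hP₂ {z : ℂ} (h1 : ρ < ‖z‖) (h2 : ‖z‖ < ρ⁻¹) : value P (q * z) ≠ 0 := fun h => by
    have hz : z ≠ 0 := norm_pos_iff.1 (hρ0.trans h1)
    have h3 := (hroots _ (mul_ne_zero hqn hz) h).2
    rw [norm_mul, mul_inv, inv_mul_lt_iff₀ hq0, inv_lt_comm₀ (norm_pos_iff.2 hz) hρ0] at h3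
    exact lt_asymm h2 h3
  set E : ℂ → ℂ := fun x => Complex.exp (2 * Real.pi * Complex.I * x) with hE
  have hE0 (x : ℂ) : E x ≠ 0 := Complex.exp_ne_zero _
  have hEd : Differentiable ℂ E := by fun_prop
  have hEnorm (x : ℂ) : ‖E x‖ = Real.exp (-(2 * Real.pi * x.im)) := norm_exp_two_pi_I_mul x
  have hqnorm := norm_eq_exp_of_eq hq
  have hpi := Real.pi_pos
  set f : ℂ → ℂ := fun x => F ((q : ℂ)⁻¹ * E x) / value P ((q : ℂ)⁻¹ * E x) with hf
  set w := quasiPeriodic τ t f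
  have hwτ : ∀ x, w (x + τ) = t * w x := quasiPeriodic_add_tau hτ
  have hw1 : ∀ x, w (x + 1) = w x := quasiPeriodic_add_one fun x => by
    simp only [hf, hE, exp_add_one]
  have hwf {x : ℂ} (h1 : 0 ≤ x.im) (h2 : x.im < τ.im) : w x = f x := by
    have := quasiPeriodic_eq (t := t) (f := f) hτ (x := x) (n := 0) (by simpa) (by simpa)
    simpa using this
  -- The gluing step. Above the real line `hF₁` applies directly; below it, `w(x) = t⁻¹ f(x+τ)` and
  -- `q⁻¹ E(x+τ) = q E(x)`, so `hF₂` gives the same function `W`.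
  have hwW {x : ℂ} (h1 : ρ < ‖E x‖) (h2 : ‖E x‖ < ρ⁻¹) : w x = W (E x) := by
    have h3 : x.im < τ.im := by
      have := hqρ.trans h1
      rw [hqnorm, hEnorm, Real.exp_lt_exp] at this
      nlinarith
    have h4 : -τ.im < x.im := by
      have := h2.trans ((inv_lt_inv₀ hρ0 hq0).2 hqρ)
      rw [hqnorm, hEnorm, ← Real.exp_neg, Real.exp_lt_exp] at this
      nlinarith
    rcases le_or_gt 0 x.im with h0 | h0
    · rw [hwf h0 h3]
      simp only [hf]
      rw [hF₁ h1 h2, mul_div_cancel_left₀ _ (hP₁ h1)]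
    · have h5 : E (x + τ) = (q : ℂ) ^ 2 * E x := by
        simp only [hE]
        rw [hq, ← Complex.exp_nat_mul, ← Complex.exp_add]
        congr 1
        push_cast
        ring
      have h6 : (q : ℂ)⁻¹ * E (x + τ) = q * E x := by
        rw [h5]
        field_simp
      have h7 := hwτ x
      rw [hwf (by simp; linarith) (by simp; linarith)] at h7
      simp only [hf] at h7
      rw [h6, hF₂ h1 h2, mul_div_assoc, mul_div_cancel_left₀ _ (hP₂ h1 h2)] at h7
      exact (mul_left_cancel₀ t.ne_zero h7).symm
  have hreal {x : ℂ} (hx : x.im = 0) : ‖E x‖ = 1 := by rw [hEnorm, hx]; simp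
  have hρi : 1 < ρ⁻¹ := (one_lt_inv₀ hρ0).2 hρ1
  have han₀ {x : ℂ} (hx : x.im = 0) : AnalyticAt ℂ w x := by
    set U : Set ℂ := {y | ρ < ‖E y‖ ∧ ‖E y‖ < ρ⁻¹} with hU
    have hUo : IsOpen U := (isOpen_lt continuous_const hEd.continuous.norm).inter
      (isOpen_lt hEd.continuous.norm continuous_const)
    have hxU : x ∈ U := by rw [hU, Set.mem_ofPred_eq, hreal hx]; exact ⟨hρ1, hρi⟩
    refine DifferentiableOn.analyticAt (s := U) (fun y hy => ?_) (hUo.mem_nhds hxU)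
    have h1 : DifferentiableAt ℂ (fun y => W (E y)) y :=
      (differentiableAt_laurentSeries hρ0 hc hy.1 hy.2).comp y (hEd y)
    refine (h1.congr_of_eventuallyEq ?_).differentiableWithinAt
    filter_upwards [hUo.mem_nhds hy] with v hv using hwW hv.1 hv.2
  have han₁ {x : ℂ} (hx : x.im = τ.im) : AnalyticAt ℂ w x := by
    have heq : w = fun y => (t : ℂ) * w (y - τ) := by
      funext y
      rw [← hwτ, sub_add_cancel]
    rw [heq]
    refine analyticAt_const.mul ?_
    exact AnalyticAt.fun_comp (han₀ (by simp [hx])) (by fun_prop)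
  have hFan {x : ℂ} (h1 : -(τ.im / 2) < x.im) (h2 : x.im < τ.im / 2) :
      AnalyticAt ℂ (fun y => F (E y)) x := by
    have hSo : IsOpen {y : ℂ | -(τ.im / 2) < y.im ∧ y.im < τ.im / 2} :=
      (isOpen_lt continuous_const Complex.continuous_im).inter
        (isOpen_lt Complex.continuous_im continuous_const)
    refine DifferentiableOn.analyticAt (fun y hy => ?_) (hSo.mem_nhds ⟨h1, h2⟩)
    have h3 : E y ∈ annulus q := (mem_strip_iff hq y).2 hy
    have h4 : DifferentiableAt ℂ (fun y => F (E y)) y :=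
      (differentiableAt_laurentSeries hs0 hd (hsq.trans h3.1) (h3.2.trans hsqi)).comp y (hEd y)
    exact h4.differentiableWithinAt
  have hPan (x : ℂ) : AnalyticAt ℂ (fun y => value P (E y)) x :=
    (differentiable_value_exp P).analyticAt x
  have hshift (x : ℂ) : (q : ℂ)⁻¹ * E x = E (x - τ / 2) := (exp_sub_half hq x).symm
  have hmer : Meromorphic w := by
    refine meromorphic_of_add_tau hτ hwτ fun x h1 h2 => ?_
    rcases h1.eq_or_lt with h0 | h0
    · exact (han₀ h0.symm).meromorphicAt
    · have hx1 : -(τ.im / 2) < (x - τ / 2).im := by simp; linarith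
      have hx2 : (x - τ / 2).im < τ.im / 2 := by simp; linarith
      have hm : MeromorphicAt (fun y => F (E (y - τ / 2)) / value P (E (y - τ / 2))) x :=
        (meromorphicAt_fun_comp_sub_const_iff_meromorphicAt (f := fun y => F (E y))).2
          (hFan hx1 hx2).meromorphicAt |>.fun_div <|
        (meromorphicAt_fun_comp_sub_const_iff_meromorphicAt (f := fun y => value P (E y))).2
          (hPan _).meromorphicAt
      refine hm.congr (EventuallyEq.filter_mono ?_ nhdsWithin_le_nhds)
      filter_upwards [Complex.continuous_im.continuousAt.eventually (lt_mem_nhds h0),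
        Complex.continuous_im.continuousAt.eventually (gt_mem_nhds h2)] with y hy1 hy2
      rw [hwf hy1.le hy2]
      simp only [hf, hshift]
  have hwP {y : ℂ} (h1 : -(τ.im / 2) < y.im) (h2 : y.im < τ.im / 2) (h3 : value P (E y) ≠ 0) :
      w (y + τ / 2) * value P (E y) = F (E y) := by
    rw [hwf (by simp; linarith) (by simp; linarith)]
    simp only [hf, hshift, add_sub_cancel_right]
    rw [div_mul_cancel₀ _ h3]
  have hWE : Continuous fun x : ℝ => W (E x) := by
    refine continuous_iff_continuousAt.2 fun x => ?_
    have h1 : ContinuousAt W (E x) := (differentiableAt_laurentSeries hρ0 hc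
      (by rwa [hreal (by simp)]) (by rwa [hreal (by simp)])).continuousAt
    exact ContinuousAt.comp (f := fun x : ℝ => E x) h1
      (hEd.continuous.comp Complex.continuous_ofReal).continuousAt
  have hwreal (x : ℝ) : w x = W (E x) :=
    hwW (by rwa [hreal (by simp)]) (by rwa [hreal (by simp)])
  refine ⟨w, ⟨hmer, hw1, hwτ, fun x hx => ?_⟩, ?_, fun R => ?_⟩
  · rw [mem_closure_strip_iff hq hq1] at hx
    -- For `x` on an edge of the strip, `x + τ/2` has imaginary part `0` or `Im τ`, where `w` itself
    -- is analytic. Inside, the product agrees with `F(E y)` away from the zeros of `P`.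
    have hbdry (hx' : AnalyticAt ℂ w (x + τ / 2)) : 0 ≤ meromorphicOrderAt
        (fun y => w (y + τ / 2) * value P (Complex.exp (2 * Real.pi * Complex.I * y))) x := by
      refine AnalyticAt.meromorphicOrderAt_nonneg (AnalyticAt.mul ?_ (hPan x))
      exact AnalyticAt.fun_comp (f := fun y => y + τ / 2) hx' (by fun_prop)
    rcases hx.1.eq_or_lt with h1 | h1
    · exact hbdry (han₀ (by simp [← h1]))
    rcases hx.2.eq_or_lt with h2 | h2
    · exact hbdry (han₁ (by simp [h2]))
    rcases (hPan x).eventually_eq_zero_or_eventually_ne_zero with h3 | h3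
    · have h4 : (fun y => w (y + τ / 2) * value P (Complex.exp (2 * Real.pi * Complex.I * y)))
          =ᶠ[𝓝[≠] x] fun _ => 0 := by
        filter_upwards [nhdsWithin_le_nhds h3] with y hy
        rw [show value P (Complex.exp (2 * Real.pi * Complex.I * y)) = 0 from hy, mul_zero]
      rw [meromorphicOrderAt_congr h4]
      exact analyticAt_const.meromorphicOrderAt_nonneg
    · have h4 : (fun y => w (y + τ / 2) * value P (Complex.exp (2 * Real.pi * Complex.I * y)))
          =ᶠ[𝓝[≠] x] fun y => F (E y) := by
        filter_upwards [h3, nhdsWithin_le_nhds (Complex.continuous_im.continuousAt.eventually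
          (lt_mem_nhds h1)), nhdsWithin_le_nhds (Complex.continuous_im.continuousAt.eventually
          (gt_mem_nhds h2))] with y hy hy1 hy2
        exact hwP hy1 hy2 hy
      rw [meromorphicOrderAt_congr h4]
      exact (hFan h1 h2).meromorphicOrderAt_nonneg
  · simp only [hwreal]
    exact hWE.intervalIntegrable 0 1
  · rw [← integral_laurentSeries hρ0 hρ1 l hc R]
    simp only [hwreal]
    rfl

end Existence

end QWeyl

end

theorem mainTheorem5 (q τ : ℂ) (hq : q = Complex.exp (Real.pi * Complex.I * τ)) (hq1 : ‖q‖ < 1)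
    (P : ℂ[T;T⁻¹]) (t : ℂˣ) :
    (∀ w : ℂ → ℂ, QWeyl.IsWeight q τ P t w →
      IntervalIntegrable (fun x : ℝ => w x) MeasureTheory.volume 0 1 →
      (∃! T : QWeyl.Alg q P →ₗ[ℂ] ℂ, QWeyl.IsGivenBy q P w T) ∧
      ∀ T : QWeyl.Alg q P →ₗ[ℂ] ℂ, QWeyl.IsGivenBy q P w T →
        QWeyl.IsTwistedTrace (QWeyl.twist q P t) T) ∧
    ((∀ z : ℂ, z ≠ 0 → QWeyl.value P z = 0 → z ∈ QWeyl.annulus q) →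
      ∀ T : QWeyl.Alg q P →ₗ[ℂ] ℂ, QWeyl.IsTwistedTrace (QWeyl.twist q P t) T →
        ∃ w : ℂ → ℂ, QWeyl.IsWeight q τ P t w ∧
          IntervalIntegrable (fun x : ℝ => w x) MeasureTheory.volume 0 1 ∧
          QWeyl.IsGivenBy q P w T) := by
  have hq0 : q ≠ 0 := by rw [hq]; exact Complex.exp_ne_zero _
  lift q to ℂˣ using hq0.isUnit
  refine ⟨fun w hw hint => ⟨?_, fun T hT => ?_⟩, fun hP T hT => ?_⟩
  · obtain ⟨T, hT₀, hT⟩ := QWeyl.exists_extension (P := P) hq1 (QWeyl.weightFunctional hint)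
    refine ⟨T, ⟨hT₀, hT⟩, fun T' hT' => QWeyl.functional_ext hT'.1 hT₀ fun R => ?_⟩
    rw [hT'.2, hT]
    rfl
  · refine QWeyl.isTwistedTrace_of_map_scale hT.1 fun S => ?_
    rw [hT.2, hT.2]
    exact hw.integral_scale hq hq1 S
  · obtain ⟨w, hw, hint, h⟩ := QWeyl.exists_weight (t := t) hq hq1 hP
      (T ∘ₗ (QWeyl.evalUnit (QWeyl.unitZ q P)).toLinearMap) fun S => by
        have h := hT.map_scale S
        rw [QWeyl.ofZ_eq, QWeyl.ofZ_eq] at h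
        exact h
    refine ⟨w, hw, hint, fun i hi a ha => hT.map_graded hq1 hi ha, fun R => ?_⟩
    rw [← h R, QWeyl.ofZ_eq]
    rfl
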